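/- All graphs are finite and simple. A plane graph is a graph $G$ drawn in $\mathbb{R}^2$ without crossings: its vertices are distinct points of $\mathbb{R}^2$, every edge is an arc (the image of an injective continuous map $[0,1]\to\mathbb{R}^2$) joining its two ends, no edge contains a vertex other than its ends, and two different edges meet only in common ends. A $5$-cycle is a cycle of length $5$, regarded as a subgraph of $G$; for a cycle $C$ of $G$, $Int(C)$ denotes the bounded component of $\mathbb{R}^2\setminus C$. A finite set $\mathcal{F}$ of cycles of $G$ is an antichain if $Int(C_1)\cap Int(C_2)=\emptyset$ for all distinct $C_1,C_2\in\mathcal{F}$, and a chain if for all $C_1,C_2\in\mathcal{F}$ either $Int(C_1)\subseteq Int(C_2)$ or $Int(C_2)\subseteq Int(C_1)$. For a vertex $v$ of $G$, let $G_v$ be the graph obtained from $G$ by deleting $v$, identifying all the neighbors of $v$ to one vertex, and deleting the resulting parallel edges. **Lemma 2.2.** Let $G$ be a triangle-free plane graph on $n$ vertices and let $k\ge 3$ be an integer. Then at least one of the following holds: (i) there exists a vertex $v$ of $G$ of degree at most $k$ such that $G_v$ is triangle-free; (ii) $G$ has an antichain $\mathcal{F}$ of $5$-cycles such that $|\mathcal{F}|\ge\sqrt{\dfrac{6(k-3)n}{35(k-1)}}$;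 (iii) $G$ has a chain $\mathcal{F}$ of $5$-cycles such that $|\mathcal{F}|\ge\sqrt{\dfrac{7(k-3)n}{30(k-1)}}$. -/

import Mathlib

/-- The Euclidean plane `ℝ²`. -/
abbrev Plane : Type := EuclideanSpace ℝ (Fin 2)

/-- `A` is an arc with ends `a` and `b`: the image of a continuous injective map of the unit
interval into the plane that sends `0` to `a` and `1` to `b`. -/
def IsArc (a b : Plane) (A : Set Plane) : Prop :=
  ∃ γ : Path a b, Function.Injective γ ∧ Set.range γ = A

/-- A drawing of the simple graph `G` in the plane without crossings. A plane graph is a graph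
together with such a drawing. -/
structure PlaneDrawing {V : Type*} (G : SimpleGraph V) where
  /-- The point of the plane that represents a vertex. -/
  point : V → Plane
  /-- The arc that represents an edge (only the values at edges of `G` matter). -/
  arc : Sym2 V → Set Plane
  /-- Distinct vertices are distinct points. -/
  point_injective : Function.Injective point
  /-- An edge `uv` is drawn as an arc between the points `u` and `v`. -/
  isArc : ∀ u v : V, G.Adj u v → IsArc (point u) (point v) (arc s(u, v))
  /-- An edge contains no vertices other than its two ends. -/
  mem_of_point_mem_arc : ∀ e ∈ G.edgeSet, ∀ w : V, point w ∈ arc e → w ∈ e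
  /-- Two different edges meet only in ends (by symmetry, in common ends). -/
  arc_inter_arc : ∀ e ∈ G.edgeSet, ∀ e' ∈ G.edgeSet, e ≠ e' →
    ∀ p ∈ arc e ∩ arc e', ∃ w ∈ e, point w = p

/-- The subgraph `C` of `G` is a cycle of length `5`: it consists of the vertices and edges of a
closed walk of length `5` without repeated vertices. Cycles are subgraphs, so that the choice of a
starting vertex and of a direction is immaterial. -/
def IsFiveCycle {V : Type*} {G : SimpleGraph V} (C : G.Subgraph) : Prop :=
  ∃ (v : V) (w : G.Walk v v), w.IsCycle ∧ w.length = 5 ∧ w.toSubgraph = C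

namespace PlaneDrawing

variable {V : Type*} {G : SimpleGraph V}

/-- The set of points of the plane covered by the vertices and edges of a subgraph. -/
def carrier (D : PlaneDrawing G) (C : G.Subgraph) : Set Plane :=
  D.point '' C.verts ∪ ⋃ e ∈ C.edgeSet, D.arc e

/-- `Int(C)`: the points off `C` whose connected component in `ℝ² - C` is bounded. When `C` is a
cycle, its carrier is a simple closed curve, and this is the bounded component of `ℝ² - C`. -/
def inside (D : PlaneDrawing G) (C : G.Subgraph) : Set Plane :=
  {p | p ∉ D.carrier C ∧ Bornology.IsBounded (connectedComponentIn (D.carrier C)ᶜ p)}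

/-- A family of cycles is an antichain if the interiors of distinct members are disjoint. -/
def IsCycleAntichain (D : PlaneDrawing G) (F : Finset G.Subgraph) : Prop :=
  ∀ C₁ ∈ F, ∀ C₂ ∈ F, C₁ ≠ C₂ → D.inside C₁ ∩ D.inside C₂ = ∅

/-- A family of cycles is a chain if the interiors of any two members are nested. -/
def IsCycleChain (D : PlaneDrawing G) (F : Finset G.Subgraph) : Prop :=
  ∀ C₁ ∈ F, ∀ C₂ ∈ F, D.inside C₁ ⊆ D.inside C₂ ∨ D.inside C₂ ⊆ D.inside C₁

end PlaneDrawing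

/-- The equivalence relation on the vertices other than `v` that identifies all the neighbours of
`v` with one another, and nothing else. -/
def neighborSetoid {V : Type*} (G : SimpleGraph V) (v : V) : Setoid {u : V // u ≠ v} where
  r x y := x = y ∨ (G.Adj v x ∧ G.Adj v y)
  iseqv :=
    { refl := fun _ => Or.inl rfl
      symm := by
        rintro x y (h | ⟨h, h'⟩)
        · exact Or.inl h.symm
        · exact Or.inr ⟨h', h⟩
      trans := by
        rintro x y z (rfl | ⟨h, h'⟩) (rfl | ⟨k, k'⟩)
        · exact Or.inl rfl
        · exact Or.inr ⟨k, k'⟩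
        · exact Or.inr ⟨h, h'⟩
        · exact Or.inr ⟨h, k'⟩ }

/-- The graph `G_v`: delete `v`, identify all the neighbours of `v` to one vertex, and delete
the resulting parallel edges. (If `G` is triangle-free, no loops arise.) -/
def identifyNeighbors {V : Type*} (G : SimpleGraph V) (v : V) :
    SimpleGraph (Quotient (neighborSetoid G v)) :=
  SimpleGraph.fromRel fun X Y => ∃ x y : {u : V // u ≠ v},
    Quotient.mk (neighborSetoid G v) x = X ∧ Quotient.mk (neighborSetoid G v) y = Y ∧
      G.Adj x y

/-!
If no vertex `v` of degree at most `k` has a triangle-free `G_v`, then every such vertex lies on a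
`5`-cycle: a triangle of `G_v` consists of the merged vertex and an edge `bc` with `b` and `c`
adjacent to different neighbours of `v` (`exists_isPentagon_of_not_cliqueFree`). In particular all
degrees are at least two. A triangle-free plane graph has at most `2n` edges
(`PlaneDrawing.card_edgeSet_le`), so at least `(k - 3) n / (k - 1)` vertices have degree at most
`k`. The vertices on `5`-cycles can be covered by a family of `5`-cycles no two of which cross
(`PlaneDrawing.exists_laminar_cover`), which therefore has at least `N = (k - 3) n / (5 (k - 1))`
members. Mirsky's theorem applied to the interiors (`card_le_mul_of_laminar`) bounds the size of the
family by the product of the sizes of a chain and of an antichain in it, and the product of the two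
square roots in the theorem is `N`.

The family comes from an uncrossing argument (`PlaneDrawing.exists_uncrossed`). Two pentagons that
cross have two common vertices that are not adjacent, and exchanging paths between these vertices
gives two pentagons with the same vertices altogether, whose interiors have the same symmetric
difference as before and do not cross the old ones. Hence the interior of a new pentagon is, up to
boundary points, the intersection, the union or a difference of the old interiors, and is crossed
only by curves that cross one of the old pentagons. So a pentagon through a given vertex that
crosses as few members as possible of a maximal family crosses none.

The topology of the plane rests on continuous logarithms, after Eilenberg: if two points `p`, `q`
off a compact set `K` are in the same component of the complement, then `(z - p) / (z - q)` has a
continuous logarithm on `K`, and if `p` is in a bounded component that does not contain `q`, then no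
product of a nonzero power of `z - p` and a power of `z - q` has one. The increments of logarithms
along arcs are winding numbers. This gives the Jordan curve theorem for the union of two arcs with
common ends, and it shows that a point off a pentagon is inside if and only if a sum of increments
over the five edges is an odd multiple of `2πi` (`PlaneDrawing.mem_inner_pentagon_iff`), from which
symmetric differences of interiors can be read off. For the bound on the number of edges, the
windings around the points of the bounded faces span the dual of the cycle space of `G`; a bounded
face of a triangle-free graph has at least four edges on its boundary, and an edge is on the
boundary of at most two faces.
-/

/-! ### Continuous logarithms -/

section LogTheory

variable {X : Type*} [TopologicalSpace X]

/-- The function `f` has a continuous logarithm on the set `K`. -/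
def HasLog (f : X → ℂ) (K : Set X) : Prop :=
  ∃ g : X → ℂ, ContinuousOn g K ∧ ∀ z ∈ K, Complex.exp (g z) = f z

theorem HasLog.mono {f : X → ℂ} {K L : Set X} (h : HasLog f K) (hL : L ⊆ K) : HasLog f L := by
  obtain ⟨g, hg, hgf⟩ := h
  exact ⟨g, hg.mono hL, fun z hz => hgf z (hL hz)⟩

theorem HasLog.congr {f f' : X → ℂ} {K : Set X} (h : HasLog f K) (hf : ∀ z ∈ K, f z = f' z) :
    HasLog f' K := by
  obtain ⟨g, hg, hgf⟩ := h
  exact ⟨g, hg, fun z hz => (hgf z hz).trans (hf z hz)⟩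

theorem HasLog.mul {f f' : X → ℂ} {K : Set X} (h : HasLog f K) (h' : HasLog f' K) :
    HasLog (fun z => f z * f' z) K := by
  obtain ⟨g, hg, hgf⟩ := h
  obtain ⟨g', hg', hgf'⟩ := h'
  exact ⟨fun z => g z + g' z, hg.add hg', fun z hz => by rw [Complex.exp_add, hgf z hz, hgf' z hz]⟩

theorem HasLog.inv {f : X → ℂ} {K : Set X} (h : HasLog f K) : HasLog (fun z => (f z)⁻¹) K := by
  obtain ⟨g, hg, hgf⟩ := h
  exact ⟨fun z => -g z, hg.neg, fun z hz => by rw [Complex.exp_neg, hgf z hz]⟩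

theorem isDiscrete_exp_eq_one : IsDiscrete {x : ℂ | Complex.exp x = 1} := by
  have : {x : ℂ | Complex.exp x = 1} = Complex.exp ⁻¹' {1} := rfl
  rw [this, isDiscrete_iff_discreteTopology]
  exact (Complex.isCoveringMapOn_exp 1 (by simp)).1

/-- Two logarithms of a function on a preconnected set differ by a constant. -/
theorem sub_eq_sub_of_exp_eq {K : Set X} (hK : IsPreconnected K) {g g' : X → ℂ}
    (hg : ContinuousOn g K) (hg' : ContinuousOn g' K)
    (h : ∀ z ∈ K, Complex.exp (g z) = Complex.exp (g' z)) {x y : X} (hx : x ∈ K) (hy : y ∈ K) :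
    g x - g' x = g y - g' y := by
  refine hK.constant_of_mapsTo isDiscrete_exp_eq_one (hg.sub hg') (fun z hz => ?_) hx hy
  simp [Complex.exp_sub, h z hz]

theorem exists_continuousOn_union_of_isClosed {K L : Set X} (hK : IsClosed K) (hL : IsClosed L)
    {g g' : X → ℂ} (hg : ContinuousOn g K) (hg' : ContinuousOn g' L)
    (h : ∀ z ∈ K ∩ L, g z = g' z) :
    ∃ G : X → ℂ, ContinuousOn G (K ∪ L) ∧ (∀ z ∈ K, G z = g z) ∧ ∀ z ∈ L, G z = g' z := by
  classical
  have h1 : ∀ z ∈ K, K.piecewise g g' z = g z := fun z hz => Set.piecewise_eq_of_mem _ _ _ hz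
  have h2 : ∀ z ∈ L, K.piecewise g g' z = g' z := fun z hz => by
    by_cases hzK : z ∈ K
    · rw [h1 z hzK, h z ⟨hzK, hz⟩]
    · exact Set.piecewise_eq_of_notMem _ _ _ hzK
  exact ⟨K.piecewise g g', (hg.congr h1).union_of_isClosed (hg'.congr h2) hK hL, h1, h2⟩

theorem exists_continuousOn_union_of_isOpen {K L : Set X} (hK : IsOpen K) (hL : IsOpen L)
    {g g' : X → ℂ} (hg : ContinuousOn g K) (hg' : ContinuousOn g' L)
    (h : ∀ z ∈ K ∩ L, g z = g' z) :
    ∃ G : X → ℂ, ContinuousOn G (K ∪ L) ∧ (∀ z ∈ K, G z = g z) ∧ ∀ z ∈ L, G z = g' z := by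
  classical
  have h1 : ∀ z ∈ K, K.piecewise g g' z = g z := fun z hz => Set.piecewise_eq_of_mem _ _ _ hz
  have h2 : ∀ z ∈ L, K.piecewise g g' z = g' z := fun z hz => by
    by_cases hzK : z ∈ K
    · rw [h1 z hzK, h z ⟨hzK, hz⟩]
    · exact Set.piecewise_eq_of_notMem _ _ _ hzK
  exact ⟨K.piecewise g g', (hg.congr h1).union_of_isOpen (hg'.congr h2) hK hL, h1, h2⟩

/-- Logarithms on two closed sets with preconnected intersection can be glued, after adding a
constant to one of them. -/
theorem HasLog.union {f : X → ℂ} {K L : Set X} (h : HasLog f K) (h' : HasLog f L)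
    (hK : IsClosed K) (hL : IsClosed L) (hKL : IsPreconnected (K ∩ L)) : HasLog f (K ∪ L) := by
  obtain ⟨g, hg, hgf⟩ := h
  obtain ⟨g', hg', hgf'⟩ := h'
  obtain ⟨c, hc, hcg⟩ : ∃ c : ℂ, Complex.exp c = 1 ∧ ∀ z ∈ K ∩ L, g z = g' z + c := by
    rcases (K ∩ L).eq_empty_or_nonempty with he | ⟨x, hx⟩
    · exact ⟨0, by simp, by simp [he]⟩
    · have hexp : ∀ z ∈ K ∩ L, Complex.exp (g z) = Complex.exp (g' z) := fun z hz => by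
        rw [hgf z hz.1, hgf' z hz.2]
      refine ⟨g x - g' x, by simp [Complex.exp_sub, hexp x hx], fun z hz => ?_⟩
      rw [sub_eq_sub_of_exp_eq hKL (hg.mono Set.inter_subset_left)
        (hg'.mono Set.inter_subset_right) hexp hx hz]
      ring
  obtain ⟨G, hG, hGK, hGL⟩ := exists_continuousOn_union_of_isClosed hK hL hg
    (hg'.add continuousOn_const) hcg
  refine ⟨G, hG, ?_⟩
  rintro z (hz | hz)
  · rw [hGK z hz, hgf z hz]
  · rw [hGL z hz]
    simp [Complex.exp_add, hc, hgf' z hz]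

/-- The increment from `u` to `v` of a logarithm of `f` on `K`; it does not depend on the logarithm
if `K` is preconnected, and it is a junk value if there is no logarithm. -/
noncomputable def logInc (f : X → ℂ) (K : Set X) (u v : X) : ℂ :=
  open Classical in if h : HasLog f K then h.choose v - h.choose u else 0

theorem logInc_eq {f : X → ℂ} {K : Set X} (hK : IsPreconnected K) {u v : X} (hu : u ∈ K)
    (hv : v ∈ K) {g : X → ℂ} (hg : ContinuousOn g K) (hgf : ∀ z ∈ K, Complex.exp (g z) = f z) :
    logInc f K u v = g v - g u := by
  have h : HasLog f K := ⟨g, hg, hgf⟩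
  rw [logInc, dif_pos h]
  have := sub_eq_sub_of_exp_eq hK h.choose_spec.1 hg
    (fun z hz => by rw [h.choose_spec.2 z hz, hgf z hz]) hu hv
  linear_combination -this

theorem logInc_symm (f : X → ℂ) (K : Set X) (u v : X) : logInc f K u v = -logInc f K v u := by
  unfold logInc
  split_ifs <;> simp

theorem exp_logInc {f : X → ℂ} {K : Set X} (h : HasLog f K) {u v : X} (hu : u ∈ K) (hv : v ∈ K) :
    Complex.exp (logInc f K u v) = f v / f u := by
  rw [logInc, dif_pos h, Complex.exp_sub, h.choose_spec.2 v hv, h.choose_spec.2 u hu]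

theorem logInc_union {f : X → ℂ} {K L : Set X} (hK : IsPreconnected K) (hL : IsPreconnected L)
    (h : HasLog f (K ∪ L)) {u v w : X} (hu : u ∈ K) (hvK : v ∈ K) (hvL : v ∈ L) (hw : w ∈ L) :
    logInc f (K ∪ L) u w = logInc f K u v + logInc f L v w := by
  obtain ⟨g, hg, hgf⟩ := h
  rw [logInc_eq (hK.union v hvK hvL hL) (Or.inl hu) (Or.inr hw) hg hgf,
    logInc_eq hK hu hvK (hg.mono Set.subset_union_left) fun z hz => hgf z (Or.inl hz),
    logInc_eq hL hvL hw (hg.mono Set.subset_union_right) fun z hz => hgf z (Or.inr hz)]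
  ring

end LogTheory

/-- A continuous function without zeros on a simply connected space has a logarithm. -/
theorem hasLog_univ {X : Type*} [TopologicalSpace X] [SimplyConnectedSpace X]
    [LocallyPathConnectedSpace X] {f : X → ℂ} (hf : Continuous f) (h0 : ∀ z, f z ≠ 0) :
    HasLog f Set.univ := by
  obtain ⟨a⟩ : Nonempty X := inferInstance
  obtain ⟨F, ⟨-, hF⟩, -⟩ := Complex.isCoveringMapOn_exp.existsUnique_continuousMap_lifts ⟨f, hf⟩
    (a₀ := a) (e₀ := Complex.log (f a)) (Complex.exp_log (h0 a)) (fun z => by simpa using h0 z)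
  exact ⟨F, F.continuous.continuousOn, fun z _ => congrFun hF z⟩

/-! ### Arcs -/

theorem IsArc.symm {a b : Plane} {A : Set Plane} (h : IsArc a b A) : IsArc b a A := by
  obtain ⟨γ, hγ, rfl⟩ := h
  refine ⟨γ.symm, fun s t hst => ?_, γ.symm_range⟩
  simpa using hγ hst

theorem IsArc.isCompact {a b : Plane} {A : Set Plane} (h : IsArc a b A) : IsCompact A := by
  obtain ⟨γ, hγ, rfl⟩ := h
  exact isCompact_range γ.continuous

theorem IsArc.isClosed {a b : Plane} {A : Set Plane} (h : IsArc a b A) : IsClosed A :=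
  h.isCompact.isClosed

theorem IsArc.left_mem {a b : Plane} {A : Set Plane} (h : IsArc a b A) : a ∈ A := by
  obtain ⟨γ, hγ, rfl⟩ := h
  exact γ.source_mem_range

theorem IsArc.right_mem {a b : Plane} {A : Set Plane} (h : IsArc a b A) : b ∈ A :=
  h.symm.left_mem

theorem IsArc.isPreconnected {a b : Plane} {A : Set Plane} (h : IsArc a b A) :
    IsPreconnected A := by
  obtain ⟨γ, hγ, rfl⟩ := h
  exact isPreconnected_range γ.continuous

theorem IsArc.isPreconnected_diff_left {a b : Plane} {A : Set Plane} (h : IsArc a b A) :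
    IsPreconnected (A \ {a}) := by
  obtain ⟨γ, hγ, rfl⟩ := h
  have : Set.range γ \ {a} = γ '' Set.Ioi 0 := by
    ext z
    constructor
    · rintro ⟨⟨t, rfl⟩, ht⟩
      refine ⟨t, ?_, rfl⟩
      rw [Set.mem_Ioi, unitInterval.pos_iff_ne_zero]
      rintro rfl
      simp at ht
    · rintro ⟨t, ht, rfl⟩
      refine ⟨⟨t, rfl⟩, fun h => ?_⟩
      have : t = 0 := hγ (by simpa using h)
      simp [this] at ht
  rw [this]
  exact isPreconnected_Ioi.image _ γ.continuous.continuousOn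

theorem IsArc.isPreconnected_diff {a b : Plane} {A : Set Plane} (h : IsArc a b A) :
    IsPreconnected (A \ {a, b}) := by
  obtain ⟨γ, hγ, rfl⟩ := h
  have : Set.range γ \ {a, b} = γ '' Set.Ioo 0 1 := by
    ext z
    constructor
    · rintro ⟨⟨t, rfl⟩, ht⟩
      refine ⟨t, ⟨?_, ?_⟩, rfl⟩
      · rw [unitInterval.pos_iff_ne_zero]
        rintro rfl
        simp at ht
      · rw [unitInterval.lt_one_iff_ne_one]
        rintro rfl
        simp at ht
    · rintro ⟨t, ht, rfl⟩
      refine ⟨⟨t, rfl⟩, ?_⟩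
      rintro (h | h)
      · have : t = 0 := hγ (by simpa using h)
        simp [this] at ht
      · have : t = 1 := hγ (by simpa using h)
        simp [this] at ht
  rw [this]
  exact isPreconnected_Ioo.image _ γ.continuous.continuousOn

theorem IsArc.subset_closure_diff {a b : Plane} {A : Set Plane} (h : IsArc a b A) :
    A ⊆ closure (A \ {a, b}) := by
  obtain ⟨γ, hγ, rfl⟩ := h
  have h1 : γ '' Set.Ioo 0 1 ⊆ Set.range γ \ {a, b} := by
    rintro _ ⟨t, ht, rfl⟩
    refine ⟨⟨t, rfl⟩, ?_⟩
    rintro (h | h)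
    · have : t = 0 := hγ (by simpa using h)
      simp [this] at ht
    · have : t = 1 := hγ (by simpa using h)
      simp [this] at ht
  have h2 : closure (Set.Ioo (0 : unitInterval) 1) = Set.univ := by
    rw [closure_Ioo zero_ne_one]
    ext t
    exact ⟨fun _ => trivial, fun _ => ⟨unitInterval.nonneg t, unitInterval.le_one t⟩⟩
  rintro _ ⟨t, rfl⟩
  refine closure_mono h1 (image_closure_subset_closure_image γ.continuous ⟨t, ?_, rfl⟩)
  rw [h2]
  trivial

/-- Continuous functions without zeros have logarithms on subarcs. -/
theorem hasLog_image_Icc {γ : unitInterval → Plane} (hc : Continuous γ)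
    (hγ : Function.Injective γ) {l r : unitInterval} (hlr : l ≤ r) {f : Plane → ℂ}
    (hf : ContinuousOn f (γ '' Set.Icc l r)) (h0 : ∀ z ∈ γ '' Set.Icc l r, f z ≠ 0) :
    HasLog f (γ '' Set.Icc l r) := by
  -- a retraction of the real line onto the interval, which makes `f ∘ γ` a function on the line
  let c : ℝ → unitInterval := fun t => max l (min r (Set.projIcc 0 1 zero_le_one t))
  have hcc : Continuous c := by fun_prop
  have hcA : ∀ t, γ (c t) ∈ γ '' Set.Icc l r := fun t =>
    ⟨_, ⟨le_max_left _ _, max_le hlr (min_le_left _ _)⟩, rfl⟩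
  obtain ⟨g, hg, hgf⟩ := hasLog_univ (f := fun t : ℝ => f (γ (c t)))
    (hf.comp_continuous (hc.comp hcc) hcA) fun t => h0 _ (hcA t)
  obtain ⟨G, hG⟩ := ContinuousMap.exists_extension (hc.isClosedEmbedding hγ)
    (⟨fun t => g t, by
      have : Continuous g := by simpa [continuousOn_univ] using hg
      fun_prop⟩ : C(unitInterval, ℂ))
  refine ⟨G, G.continuous.continuousOn, ?_⟩
  rintro _ ⟨t, ht, rfl⟩
  have h1 : G (γ t) = g t := DFunLike.congr_fun hG t
  rw [h1, hgf _ trivial]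
  simp [c, min_eq_right ht.2, max_eq_right ht.1]

theorem IsArc.hasLog {a b : Plane} {A : Set Plane} (h : IsArc a b A) {f : Plane → ℂ}
    (hf : ContinuousOn f A) (h0 : ∀ z ∈ A, f z ≠ 0) : HasLog f A := by
  obtain ⟨γ, hγ, rfl⟩ := h
  have : Set.range γ = γ '' Set.Icc 0 1 := by
    rw [← Set.image_univ]
    congr 1
    exact (Set.eq_univ_of_forall fun t => Set.mem_Icc.2
      ⟨unitInterval.nonneg t, unitInterval.le_one t⟩).symm
  rw [this] at hf h0 ⊢
  exact hasLog_image_Icc γ.continuous hγ zero_le_one hf h0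

/-! ### Components of the complement of a compact plane set -/

/-- The isometry that identifies the Euclidean plane with the complex plane. -/
noncomputable def planeToComplex : Plane ≃ₗᵢ[ℝ] ℂ := Complex.orthonormalBasisOneI.repr.symm

/-- The difference `z - p` as a complex number. -/
noncomputable def diffC (p z : Plane) : ℂ := planeToComplex z - planeToComplex p

theorem norm_diffC (p z : Plane) : ‖diffC p z‖ = dist z p := by
  rw [diffC, ← map_sub, LinearIsometryEquiv.norm_map, dist_eq_norm]

theorem diffC_ne_zero {p z : Plane} (h : z ≠ p) : diffC p z ≠ 0 := by
  rw [← norm_pos_iff, norm_diffC]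
  exact dist_pos.2 h

theorem diffC_ne_zero_of_notMem {p z : Plane} {K : Set Plane} (hp : p ∉ K) (hz : z ∈ K) :
    diffC p z ≠ 0 :=
  diffC_ne_zero fun h => hp (h ▸ hz)

@[fun_prop]
theorem continuous_diffC (p : Plane) : Continuous (diffC p) := by
  unfold diffC
  fun_prop

/-- On a circle, the `n`-th power of the distance vector from the centre times an `M`-th power has a
logarithm only if `M` divides `n`. -/
theorem dvd_of_hasLog_sphere {p : Plane} {r : ℝ} (hr : 0 < r) {F : Plane → ℂ}
    (hF : ContinuousOn F (Metric.sphere p r)) (hF0 : ∀ z ∈ Metric.sphere p r, F z ≠ 0) {M : ℕ}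
    {n : ℤ} (h : HasLog (fun z => F z ^ M * diffC p z ^ n) (Metric.sphere p r)) : (M : ℤ) ∣ n := by
  -- the circle, in the coordinate in which `log (z - p)` is `log r + iθ`
  let c : ℝ → Plane := fun θ => planeToComplex.symm
    (planeToComplex p + Complex.exp (Real.log r + θ * Complex.I))
  have hc : Continuous c := by fun_prop
  have hcd : ∀ θ, diffC p (c θ) = Complex.exp (Real.log r + θ * Complex.I) := fun θ => by
    simp [c, diffC]
  have hcs : ∀ θ, c θ ∈ Metric.sphere p r := fun θ => by
    rw [Metric.mem_sphere, ← norm_diffC, hcd, Complex.norm_exp]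
    simp [Real.exp_log hr]
  have hper : c (2 * Real.pi) = c 0 := by
    simp only [c, Complex.exp_add]
    push_cast
    rw [Complex.exp_two_pi_mul_I]
    simp
  obtain ⟨g, hg, hgf⟩ := h
  obtain ⟨ρ, hρ, hρf⟩ := hasLog_univ (hF.comp_continuous hc hcs) fun θ => hF0 _ (hcs θ)
  have hρj : Complex.exp (ρ (2 * Real.pi)) = Complex.exp (ρ 0) := by
    rw [hρf _ trivial, hρf _ trivial, Function.comp_apply, Function.comp_apply, hper]
  obtain ⟨j, hj⟩ := Complex.exp_eq_exp_iff_exists_int.1 hρj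
  have key := sub_eq_sub_of_exp_eq (K := (Set.univ : Set ℝ)) isPreconnected_univ
    (g := fun θ => g (c θ)) (g' := fun θ => M * ρ θ + n * (Real.log r + θ * Complex.I))
    (hg.comp_continuous hc hcs).continuousOn
    (by
      refine ContinuousOn.add (continuousOn_const.mul hρ) ?_
      fun_prop)
    (fun θ _ => by
      rw [hgf _ (hcs θ)]
      simp only []
      rw [hcd, Complex.exp_add (M * ρ θ), Complex.exp_nat_mul, Complex.exp_int_mul,
        hρf θ trivial, Function.comp_apply])
    (Set.mem_univ 0) (Set.mem_univ (2 * Real.pi))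
  simp only [hper, hj] at key
  have h2 : ((M : ℂ) * j + n) * (2 * Real.pi * Complex.I) = 0 := by
    push_cast at key
    linear_combination key
  rcases mul_eq_zero.1 h2 with h3 | h3
  · exact ⟨-j, by
      have : (M : ℤ) * j + n = 0 := by exact_mod_cast h3
      linarith⟩
  · exact absurd h3 Complex.two_pi_I_ne_zero

/-- The points off `K` in bounded components of the complement of `K`. -/
def inner (K : Set Plane) : Set Plane :=
  {p | p ∉ K ∧ Bornology.IsBounded (connectedComponentIn Kᶜ p)}

/-- The points off `K` in unbounded components of the complement of `K`. -/
def outer (K : Set Plane) : Set Plane :=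
  {p | p ∉ K ∧ ¬ Bornology.IsBounded (connectedComponentIn Kᶜ p)}

theorem isOpen_inner {K : Set Plane} (hK : IsClosed K) : IsOpen (inner K) := by
  rw [isOpen_iff_mem_nhds]
  rintro p ⟨hp, hb⟩
  have ho : IsOpen (connectedComponentIn Kᶜ p) := hK.isOpen_compl.connectedComponentIn
  refine Filter.mem_of_superset (ho.mem_nhds (mem_connectedComponentIn hp)) fun q hq => ?_
  refine ⟨connectedComponentIn_subset _ _ hq, ?_⟩
  rwa [← connectedComponentIn_eq hq]

theorem isOpen_outer {K : Set Plane} (hK : IsClosed K) : IsOpen (outer K) := by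
  rw [isOpen_iff_mem_nhds]
  rintro p ⟨hp, hb⟩
  have ho : IsOpen (connectedComponentIn Kᶜ p) := hK.isOpen_compl.connectedComponentIn
  refine Filter.mem_of_superset (ho.mem_nhds (mem_connectedComponentIn hp)) fun q hq => ?_
  refine ⟨connectedComponentIn_subset _ _ hq, ?_⟩
  rwa [← connectedComponentIn_eq hq]

theorem disjoint_inner_outer (K : Set Plane) : Disjoint (inner K) (outer K) :=
  Set.disjoint_left.2 fun _ h h' => h'.2 h.2

theorem mem_inner_or_mem_outer {K : Set Plane} {p : Plane} (hp : p ∉ K) :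
    p ∈ inner K ∨ p ∈ outer K := by
  by_cases h : Bornology.IsBounded (connectedComponentIn Kᶜ p)
  · exact Or.inl ⟨hp, h⟩
  · exact Or.inr ⟨hp, h⟩

theorem subset_inner_or_subset_outer {K S : Set Plane} (hS : IsPreconnected S)
    (hSK : Disjoint S K) : S ⊆ inner K ∨ S ⊆ outer K := by
  rcases S.eq_empty_or_nonempty with rfl | ⟨x, hx⟩
  · simp
  have hsub := hS.subset_connectedComponentIn hx (Set.subset_compl_iff_disjoint_right.2 hSK)
  have heq : ∀ y ∈ S, connectedComponentIn Kᶜ x = connectedComponentIn Kᶜ y := fun y hy =>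
    connectedComponentIn_eq (hsub hy)
  by_cases h : Bornology.IsBounded (connectedComponentIn Kᶜ x)
  · exact Or.inl fun y hy => ⟨Set.disjoint_left.1 hSK hy, heq y hy ▸ h⟩
  · exact Or.inr fun y hy => ⟨Set.disjoint_left.1 hSK hy, heq y hy ▸ h⟩

theorem isPreconnected_norm_gt (R : ℝ) (hR : 0 ≤ R) : IsPreconnected {z : Plane | R < ‖z‖} := by
  have hrank : 1 < Module.rank ℝ Plane := by
    rw [← Module.finrank_eq_rank]
    simp
  have h := (isPreconnected_Ioi (a := R)).prod (isPreconnected_sphere hrank (0 : Plane) 1)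
  have := h.image (fun q : ℝ × Plane => q.1 • q.2) (by fun_prop)
  convert this using 1
  ext z
  simp only [Set.mem_ofPred_eq, Set.mem_image, Set.mem_prod, Set.mem_Ioi, mem_sphere_zero_iff_norm,
    Prod.exists]
  constructor
  · intro hz
    have hz0 : ‖z‖ ≠ 0 := (hR.trans_lt hz).ne'
    exact ⟨‖z‖, ‖z‖⁻¹ • z, ⟨hz, by simp [norm_smul, hz0]⟩, by simp [smul_smul, hz0]⟩
  · rintro ⟨a, y, ⟨ha, hy⟩, rfl⟩
    rw [norm_smul, hy, mul_one, Real.norm_of_nonneg (hR.trans ha.le)]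
    exact ha

theorem exists_norm_gt (R : ℝ) : ∃ z : Plane, R < ‖z‖ := by
  obtain ⟨z, hz⟩ := NormedSpace.exists_lt_norm ℝ Plane R
  exact ⟨z, hz⟩

theorem exists_bound {K : Set Plane} (hK : IsCompact K) :
    ∃ R : ℝ, 0 ≤ R ∧ ∀ z ∈ K, ‖z‖ ≤ R := by
  obtain ⟨R, hR⟩ := hK.isBounded.exists_norm_le
  exact ⟨max R 0, le_max_right _ _, fun z hz => (hR z hz).trans (le_max_left _ _)⟩

/-- The unbounded component of the complement contains all points far away. -/
theorem exists_mem_connectedComponentIn_norm_gt {K : Set Plane} {R : ℝ} (hR0 : 0 ≤ R)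
    (hR : ∀ z ∈ K, ‖z‖ ≤ R) {p : Plane} (hp : p ∈ outer K) :
    {z : Plane | R < ‖z‖} ⊆ connectedComponentIn Kᶜ p := by
  have hfar : ∃ y ∈ connectedComponentIn Kᶜ p, R < ‖y‖ := by
    by_contra! hcon
    exact hp.2 (isBounded_iff_forall_norm_le.2 ⟨R, hcon⟩)
  obtain ⟨y, hy, hyR⟩ := hfar
  rw [connectedComponentIn_eq hy]
  exact (isPreconnected_norm_gt R hR0).subset_connectedComponentIn hyR
    fun z hz hzK => absurd (hR z hzK) (not_le.2 hz)

theorem isPreconnected_outer {K : Set Plane} (hK : IsCompact K) : IsPreconnected (outer K) := by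
  obtain ⟨R, hR0, hR⟩ := exists_bound hK
  obtain ⟨z, hz⟩ := exists_norm_gt R
  have : outer K ⊆ connectedComponentIn Kᶜ z := fun p hp => by
    rw [← connectedComponentIn_eq (exists_mem_connectedComponentIn_norm_gt hR0 hR hp hz)]
    exact mem_connectedComponentIn hp.1
  rcases (outer K).eq_empty_or_nonempty with he | ⟨p, hp⟩
  · rw [he]
    exact isPreconnected_empty
  have hpz := this hp
  have heq : outer K = connectedComponentIn Kᶜ z := by
    refine this.antisymm fun q hq => ⟨connectedComponentIn_subset _ _ hq, ?_⟩
    rw [← connectedComponentIn_eq hq, connectedComponentIn_eq hpz]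
    exact hp.2
  rw [heq]
  exact isPreconnected_connectedComponentIn

theorem norm_gt_subset_outer {K : Set Plane} {R : ℝ} (hR0 : 0 ≤ R)
    (hR : ∀ z ∈ K, ‖z‖ ≤ R) : {z : Plane | R < ‖z‖} ⊆ outer K := by
  have hdisj : {z : Plane | R < ‖z‖} ⊆ Kᶜ := fun z hz hzK => absurd (hR z hzK) (not_le.2 hz)
  intro z hz
  refine ⟨hdisj hz, fun hb => ?_⟩
  obtain ⟨R', hR'⟩ := hb.exists_norm_le
  obtain ⟨y, hy⟩ := exists_norm_gt (max R R')
  have := hR' y ((isPreconnected_norm_gt R hR0).subset_connectedComponentIn hz hdisj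
    ((le_max_left _ _).trans_lt hy))
  exact absurd ((le_max_right _ _).trans_lt hy) (not_lt.2 this)

theorem not_isBounded_outer {K : Set Plane} (hK : IsCompact K) :
    ¬ Bornology.IsBounded (outer K) := by
  obtain ⟨R, hR0, hR⟩ := exists_bound hK
  intro hb
  obtain ⟨R', hR'⟩ := hb.exists_norm_le
  obtain ⟨y, hy⟩ := exists_norm_gt (max R R')
  exact absurd ((le_max_right _ _).trans_lt hy)
    (not_lt.2 (hR' y (norm_gt_subset_outer hR0 hR ((le_max_left _ _).trans_lt hy))))

/-- The maximum principle for components: a connected unbounded set that avoids `K` lies in the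
outer component. -/
theorem subset_outer_of_not_isBounded {K S : Set Plane} (hS : IsPreconnected S)
    (hSK : Disjoint S K) (hSb : ¬ Bornology.IsBounded S) : S ⊆ outer K := by
  intro x hx
  refine ⟨Set.disjoint_left.1 hSK hx, fun hb => hSb (hb.subset ?_)⟩
  exact hS.subset_connectedComponentIn hx (Set.subset_compl_iff_disjoint_right.2 hSK)

theorem hasLog_one_add {X : Type*} [TopologicalSpace X] {f : X → ℂ} {K : Set X}
    (hf : ContinuousOn f K) (h : ∀ z ∈ K, ‖f z‖ < 1) : HasLog (fun z => 1 + f z) K := by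
  refine ⟨fun z => Complex.log (1 + f z), ContinuousOn.clog (continuousOn_const.add hf)
    fun z hz => Complex.mem_slitPlane_of_norm_lt_one (h z hz), fun z hz => ?_⟩
  exact Complex.exp_log (Complex.slitPlane_ne_zero (Complex.mem_slitPlane_of_norm_lt_one (h z hz)))

/-- If `p` and `q` are in the same component of the complement of `K`, then the quotient of the
distance vectors from `p` and `q` has a logarithm on `K`. -/
theorem hasLog_div_of_isPreconnected {K W : Set Plane} (hK : IsClosed K) (hW : IsPreconnected W)
    (hWK : Disjoint W K) {p q : Plane} (hp : p ∈ W) (hq : q ∈ W) :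
    HasLog (fun z => diffC p z / diffC q z) K := by
  have hne : ∀ x ∈ W, ∀ z ∈ K, diffC x z ≠ 0 := fun x hx z hz =>
    diffC_ne_zero_of_notMem (Set.disjoint_left.1 hWK hx) hz
  refine hW.induction₂ (fun p q => HasLog (fun z => diffC p z / diffC q z) K) ?_ ?_ ?_ hp hq
  · intro x hx
    obtain ⟨r, hr, hball⟩ := Metric.isOpen_iff.1 hK.isOpen_compl x (Set.disjoint_left.1 hWK hx)
    refine mem_nhdsWithin_of_mem_nhds (Filter.mem_of_superset (Metric.ball_mem_nhds x hr) ?_)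
    intro y hy
    have hfar : ∀ z ∈ K, dist y x < dist z x := fun z hz => by
      have h1 : z ∉ Metric.ball x r := fun hz' => hball hz' hz
      rw [Metric.mem_ball, not_lt] at h1
      exact (Metric.mem_ball.1 hy).trans_le h1
    have h1 : HasLog (fun z => 1 + -(diffC x y / diffC x z)) K := by
      refine hasLog_one_add ?_ fun z hz => ?_
      · exact (continuousOn_const.div (continuous_diffC x).continuousOn (hne x hx)).neg
      · rw [norm_neg, norm_div, norm_diffC, norm_diffC,
          div_lt_one (dist_nonneg.trans_lt (hfar z hz))]
        exact hfar z hz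
    refine h1.inv.congr fun z hz => ?_
    have h2 := hne x hx z hz
    have h3 : 1 + -(diffC x y / diffC x z) = diffC y z / diffC x z := by
      field_simp
      simp only [diffC]
      ring
    rw [h3, inv_div]
  · intro x y z _ hy _ h1 h2
    refine (h1.mul h2).congr fun w hw => ?_
    have := hne y hy w hw
    field_simp
  · intro x y _ _ h
    exact h.inv.congr fun w _ => inv_div _ _

theorem hasLog_const {X : Type*} [TopologicalSpace X] {c : ℂ} (hc : c ≠ 0) (K : Set X) :
    HasLog (fun _ => c) K :=
  ⟨fun _ => Complex.log c, continuousOn_const, fun _ _ => Complex.exp_log hc⟩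

theorem hasLog_diffC_of_far {K : Set Plane} {R : ℝ} (hR : ∀ z ∈ K, ‖z‖ ≤ R) {p : Plane}
    (hp : R < ‖p‖) : HasLog (diffC p) K := by
  rcases K.eq_empty_or_nonempty with rfl | ⟨z₀, hz₀⟩
  · exact ⟨0, continuousOn_empty _, by simp⟩
  have hR0 : 0 ≤ R := (norm_nonneg _).trans (hR z₀ hz₀)
  have hp0 : planeToComplex p ≠ 0 := by
    rw [← norm_pos_iff, LinearIsometryEquiv.norm_map]
    exact hR0.trans_lt hp
  have h1 : HasLog (fun z => 1 + -(planeToComplex z / planeToComplex p)) K := by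
    refine hasLog_one_add (by fun_prop) fun z hz => ?_
    rw [norm_neg, norm_div, LinearIsometryEquiv.norm_map, LinearIsometryEquiv.norm_map,
      div_lt_one (hR0.trans_lt hp)]
    exact (hR z hz).trans_lt hp
  refine (h1.mul (hasLog_const (neg_ne_zero.2 hp0) K)).congr fun z hz => ?_
  simp only [diffC]
  field_simp
  ring

theorem hasLog_diffC_of_mem_outer {K : Set Plane} (hK : IsCompact K) {p : Plane}
    (hp : p ∈ outer K) : HasLog (diffC p) K := by
  obtain ⟨R, hR0, hR⟩ := exists_bound hK
  obtain ⟨q, hq⟩ := exists_norm_gt R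
  have hqo := norm_gt_subset_outer hR0 hR hq
  have hdisj : Disjoint (outer K) K := Set.disjoint_left.2 fun x hx => hx.1
  refine ((hasLog_div_of_isPreconnected hK.isClosed (isPreconnected_outer hK) hdisj hp hqo).mul
    (hasLog_diffC_of_far hR hq)).congr fun z hz => ?_
  exact div_mul_cancel₀ _ (diffC_ne_zero_of_notMem hqo.1 hz)

/-- Eilenberg's criterion: if `p` is in a bounded component of the complement of `K` that does not
contain `q`, then a product of a nonzero power of `z - p` and a power of `z - q` has no logarithm
on `K`. -/
theorem eq_zero_of_hasLog {K : Set Plane} (hK : IsCompact K) {p q : Plane} (hp : p ∈ inner K)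
    (hq : q ∉ K) (hpq : q ∉ connectedComponentIn Kᶜ p) {a b : ℤ}
    (h : HasLog (fun z => diffC p z ^ a * diffC q z ^ b) K) : a = 0 := by
  set U := connectedComponentIn Kᶜ p with hU
  have hUo : IsOpen U := hK.isClosed.isOpen_compl.connectedComponentIn
  have hpU : p ∈ U := mem_connectedComponentIn hp.1
  have hUK : ∀ z ∈ closure U, z ∉ K → z ∈ U := fun z hz hzK => by
    have hVo : IsOpen (connectedComponentIn Kᶜ z) := hK.isClosed.isOpen_compl.connectedComponentIn
    obtain ⟨y, hy, hyU⟩ := mem_closure_iff.1 hz _ hVo (mem_connectedComponentIn hzK)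
    rw [hU, connectedComponentIn_eq hyU, ← connectedComponentIn_eq hy]
    exact mem_connectedComponentIn hzK
  obtain ⟨g, hg, hgf⟩ := h
  obtain ⟨G, hG⟩ := ContinuousMap.exists_restrict_eq hK.isClosed
    (⟨K.domRestrict g, continuousOn_iff_continuous_domRestrict.1 hg⟩ : C(K, ℂ))
  have hGg : ∀ z ∈ K, G z = g z := fun z hz => DFunLike.congr_fun hG ⟨z, hz⟩
  have hq0 : ∀ z ∈ closure U, diffC q z ≠ 0 := fun z hz => by
    refine diffC_ne_zero ?_
    rintro rfl
    exact hpq (hUK z hz hq)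
  have hp0 : ∀ z ∈ Uᶜ, diffC p z ≠ 0 := fun z hz => by
    refine diffC_ne_zero ?_
    rintro rfl
    exact hz hpU
  -- `exp G / (z - q) ^ b` on the component of `p` and `(z - p) ^ a` elsewhere agree on `K`, so that
  -- they form a function without zeros on the plane, which has a logarithm
  obtain ⟨F, hF, hF1, hF2⟩ := exists_continuousOn_union_of_isClosed (K := closure U) (L := Uᶜ)
    isClosed_closure hUo.isClosed_compl
    (g := fun z => Complex.exp (G z) * diffC q z ^ (-b)) (g' := fun z => diffC p z ^ a)
    (ContinuousOn.mul (by fun_prop) ((continuous_diffC q).continuousOn.zpow₀ _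
      fun z hz => Or.inl (hq0 z hz)))
    ((continuous_diffC p).continuousOn.zpow₀ _ fun z hz => Or.inl (hp0 z hz))
    (fun z hz => by
      have hzK : z ∈ K := by
        by_contra hzK
        exact hz.2 (hUK z hz.1 hzK)
      have := hq0 z hz.1
      simp only [hGg z hzK, hgf z hzK, zpow_neg]
      field_simp)
  have huniv : closure U ∪ Uᶜ = Set.univ := by
    rw [Set.eq_univ_iff_forall]
    intro z
    by_cases hz : z ∈ U
    · exact Or.inl (subset_closure hz)
    · exact Or.inr hz
  rw [huniv, continuousOn_univ] at hF
  have hlog : HasLog F Set.univ := by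
    refine hasLog_univ hF fun z => ?_
    by_cases hz : z ∈ U
    · rw [hF1 z (subset_closure hz)]
      exact mul_ne_zero (Complex.exp_ne_zero _) (zpow_ne_zero _ (hq0 z (subset_closure hz)))
    · rw [hF2 z hz]
      exact zpow_ne_zero _ (hp0 z hz)
  -- on a circle around the component of `p`, this function is `(z - p) ^ a`
  obtain ⟨r, hr, hUr⟩ := (hp.2.subset_ball_lt 0 p : _)
  have hsphere : HasLog (fun z => (1 : ℂ) ^ 0 * diffC p z ^ a) (Metric.sphere p r) := by
    refine (hlog.mono (Set.subset_univ _)).congr fun z hz => ?_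
    rw [hF2 z fun hzU => (Metric.sphere_disjoint_ball.le_bot ⟨hz, hUr hzU⟩ : _)]
    simp
  have := dvd_of_hasLog_sphere (F := fun _ => 1) (M := 0) hr continuousOn_const (by simp) hsphere
  simpa using this

theorem notMem_inner_of_hasLog {K : Set Plane} (hK : IsCompact K) {p : Plane}
    (h : HasLog (diffC p) K) : p ∉ inner K := by
  intro hp
  obtain ⟨R, hR0, hR⟩ := exists_bound hK
  obtain ⟨q, hq⟩ := exists_norm_gt R
  have hqo := norm_gt_subset_outer hR0 hR hq
  have := eq_zero_of_hasLog hK hp hqo.1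
    (fun hpq => hqo.2 (by rw [← connectedComponentIn_eq hpq]; exact hp.2)) (a := 1) (b := 0)
    (h.congr fun z _ => by simp)
  exact one_ne_zero this

/-- A compact set on which all continuous functions without zeros have logarithms. -/
def IsLogTrivial (K : Set Plane) : Prop :=
  IsCompact K ∧ ∀ f : Plane → ℂ, ContinuousOn f K → (∀ z ∈ K, f z ≠ 0) → HasLog f K

theorem IsArc.isLogTrivial {a b : Plane} {A : Set Plane} (h : IsArc a b A) : IsLogTrivial A :=
  ⟨h.isCompact, fun _ hf h0 => h.hasLog hf h0⟩

theorem IsLogTrivial.union {K L : Set Plane} (hK : IsLogTrivial K) (hL : IsLogTrivial L)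
    (h : IsPreconnected (K ∩ L)) : IsLogTrivial (K ∪ L) :=
  ⟨hK.1.union hL.1, fun f hf h0 =>
    (hK.2 f (hf.mono Set.subset_union_left) fun z hz => h0 z (Or.inl hz)).union
      (hL.2 f (hf.mono Set.subset_union_right) fun z hz => h0 z (Or.inr hz))
      hK.1.isClosed hL.1.isClosed h⟩

theorem isLogTrivial_singleton (x : Plane) : IsLogTrivial {x} :=
  ⟨isCompact_singleton, fun f _ h0 =>
    ⟨fun _ => Complex.log (f x), continuousOn_const, fun z hz => by
      rw [Set.mem_singleton_iff.1 hz, Complex.exp_log (h0 x rfl)]⟩⟩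

theorem isLogTrivial_empty : IsLogTrivial ∅ :=
  ⟨isCompact_empty, fun _ _ _ => ⟨0, continuousOn_empty _, by simp⟩⟩

theorem IsLogTrivial.union_finite {K S : Set Plane} (hK : IsLogTrivial K) (hS : S.Finite) :
    IsLogTrivial (K ∪ S) := by
  induction S, hS using Set.Finite.induction_on with
  | empty => simpa using hK
  | insert _ _ ih =>
    rw [Set.insert_eq, Set.union_left_comm]
    refine (isLogTrivial_singleton _).union ih ?_
    exact (Set.subsingleton_singleton.anti Set.inter_subset_left).isPreconnected

theorem IsLogTrivial.hasLog_diffC {K : Set Plane} (hK : IsLogTrivial K) {p : Plane} (hp : p ∉ K) :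
    HasLog (diffC p) K :=
  hK.2 _ (continuous_diffC p).continuousOn fun _ hz => diffC_ne_zero_of_notMem hp hz

/-- A compact set on which all logarithms exist does not separate the plane. -/
theorem inner_eq_empty_of_hasLog {K : Set Plane} (hK : IsCompact K)
    (h : ∀ p ∉ K, HasLog (diffC p) K) : inner K = ∅ :=
  Set.eq_empty_of_forall_notMem fun p hp => notMem_inner_of_hasLog hK (h p hp.1) hp

theorem isPreconnected_compl_of_hasLog {K : Set Plane} (hK : IsCompact K)
    (h : ∀ p ∉ K, HasLog (diffC p) K) : IsPreconnected Kᶜ := by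
  have : Kᶜ = outer K := by
    ext p
    refine ⟨fun hp => ?_, fun hp => hp.1⟩
    have := mem_inner_or_mem_outer hp
    rwa [inner_eq_empty_of_hasLog hK h, Set.mem_empty_iff_false, false_or] at this
  rw [this]
  exact isPreconnected_outer hK

/-- An open set whose frontier lies in a compact set that does not separate the plane is empty or
contains the complement of that set. -/
theorem compl_subset_of_frontier_subset {K S : Set Plane} (hK : IsCompact K)
    (h : ∀ p ∉ K, HasLog (diffC p) K) (hS : IsOpen S) (hSK : closure S ⊆ S ∪ K)
    (hne : (S \ K).Nonempty) : Kᶜ ⊆ S := by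
  refine (isPreconnected_compl_of_hasLog hK h).subset_left_of_subset_union hS
    isClosed_closure.isOpen_compl
    (Set.disjoint_left.2 fun x hx hx' => hx' (subset_closure hx)) (fun x hx => ?_) ?_
  · by_cases hxS : x ∈ closure S
    · rcases hSK hxS with h1 | h1
      · exact Or.inl h1
      · exact absurd h1 hx
    · exact Or.inr hxS
  · obtain ⟨x, hx, hxK⟩ := hne
    exact ⟨x, hxK, hx⟩

/-- Removing a neighbourhood of an interior point from an arc leaves a set that is covered by two
disjoint subarcs, one at each end. -/
theorem IsArc.exists_split {a b : Plane} {A : Set Plane} (h : IsArc a b A) {x : Plane}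
    (hx : x ∈ A \ {a, b}) {U : Set Plane} (hU : IsOpen U) (hxU : x ∈ U) :
    ∃ A₁ A₂ : Set Plane, IsLogTrivial A₁ ∧ IsLogTrivial A₂ ∧ A₁ ⊆ A ∧ A₂ ⊆ A ∧ A \ U ⊆ A₁ ∪ A₂ ∧
      a ∈ A₁ ∧ b ∈ A₂ ∧ Disjoint A₁ A₂ := by
  obtain ⟨γ, hγ, rfl⟩ := h
  obtain ⟨⟨t, rfl⟩, ht⟩ := hx
  have ht0 : 0 < t := by
    rw [unitInterval.pos_iff_ne_zero]
    rintro rfl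
    simp at ht
  have ht1 : t < 1 := by
    rw [unitInterval.lt_one_iff_ne_one]
    rintro rfl
    simp at ht
  have hnhds : γ ⁻¹' U ∈ nhds t := (hU.preimage γ.continuous).mem_nhds hxU
  obtain ⟨l, r, hlr, hsub⟩ := (mem_nhds_iff_exists_Ioo_subset' ⟨0, ht0⟩ ⟨1, ht1⟩).1 hnhds
  refine ⟨γ '' Set.Iic l, γ '' Set.Ici r, ?_, ?_, Set.image_subset_range _ _,
    Set.image_subset_range _ _, ?_, ⟨0, unitInterval.nonneg l, by simp⟩,
    ⟨1, unitInterval.le_one r, by simp⟩, ?_⟩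
  · have : Set.Iic l = Set.Icc 0 l := by
      ext s
      simp
    rw [this]
    exact ⟨isCompact_Icc.image γ.continuous, fun _ hf h0 =>
      hasLog_image_Icc γ.continuous hγ (unitInterval.nonneg l) hf h0⟩
  · have : Set.Ici r = Set.Icc r 1 := by
      ext s
      exact ⟨fun hs => ⟨hs, unitInterval.le_one s⟩, fun hs => hs.1⟩
    rw [this]
    exact ⟨isCompact_Icc.image γ.continuous, fun _ hf h0 =>
      hasLog_image_Icc γ.continuous hγ (unitInterval.le_one r) hf h0⟩
  · rintro _ ⟨⟨s, rfl⟩, hs⟩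
    by_contra hcon
    simp only [Set.mem_union, not_or] at hcon
    refine hs (hsub ⟨?_, ?_⟩)
    · by_contra hle
      exact hcon.1 ⟨s, not_lt.1 hle, rfl⟩
    · by_contra hle
      exact hcon.2 ⟨s, not_lt.1 hle, rfl⟩
  · rw [Set.disjoint_image_iff hγ, Set.disjoint_left]
    intro s hs hs'
    exact absurd (hlr.1.trans hlr.2) (not_lt.2 (le_trans hs' hs))

/-! ### The Jordan curve theorem -/

theorem IsArc.ne {a b : Plane} {A : Set Plane} (h : IsArc a b A) : a ≠ b := by
  obtain ⟨γ, hγ, -⟩ := h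
  intro hab
  have : γ 0 = γ 1 := by simp [hab]
  exact zero_ne_one (hγ this)

theorem continuousAt_logInc_diffC {K : Set Plane} (hK : IsClosed K) (hKc : IsPreconnected K)
    {u v : Plane} (hu : u ∈ K) (hv : v ∈ K) {p : Plane} (hp : p ∉ K)
    (h : HasLog (diffC p) K) : ContinuousAt (fun q => logInc (diffC q) K u v) p := by
  obtain ⟨g, hg, hgf⟩ := h
  obtain ⟨r, hr, hball⟩ := Metric.isOpen_iff.1 hK.isOpen_compl p hp
  have hne : ∀ z ∈ K, diffC p z ≠ 0 := fun z hz => diffC_ne_zero_of_notMem hp hz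
  have hslit : ∀ q ∈ Metric.ball p r, ∀ z ∈ K,
      1 + -(diffC p q / diffC p z) ∈ Complex.slitPlane := by
    intro q hq z hz
    refine Complex.mem_slitPlane_of_norm_lt_one ?_
    have h1 : z ∉ Metric.ball p r := fun hz' => hball hz' hz
    rw [Metric.mem_ball, not_lt] at h1
    have h2 : dist q p < dist z p := (Metric.mem_ball.1 hq).trans_le h1
    rw [norm_neg, norm_div, norm_diffC, norm_diffC, div_lt_one (dist_nonneg.trans_lt h2)]
    exact h2
  have heq : ∀ q ∈ Metric.ball p r, logInc (diffC q) K u v =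
      (g v + Complex.log (1 + -(diffC p q / diffC p v))) -
        (g u + Complex.log (1 + -(diffC p q / diffC p u))) := by
    intro q hq
    refine logInc_eq hKc hu hv (g := fun z => g z + Complex.log (1 + -(diffC p q / diffC p z)))
      (hg.add (ContinuousOn.clog (continuousOn_const.add (continuousOn_const.div
        (continuous_diffC p).continuousOn hne).neg) (hslit q hq))) fun z hz => ?_
    rw [Complex.exp_add, hgf z hz, Complex.exp_log (Complex.slitPlane_ne_zero (hslit q hq z hz))]
    have := hne z hz
    field_simp
    simp only [diffC]
    ring
  have hpb : p ∈ Metric.ball p r := Metric.mem_ball_self hr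
  refine ContinuousAt.congr ?_ (Filter.mem_of_superset (Metric.ball_mem_nhds p hr)
    fun q hq => (heq q hq).symm)
  have hlog : ∀ z ∈ K, ContinuousAt (fun q => Complex.log (1 + -(diffC p q / diffC p z))) p :=
    fun z hz => ContinuousAt.clog (continuousAt_const.add
      ((continuous_diffC p).continuousAt.div_const _).neg) (hslit p hpb z hz)
  exact (continuousAt_const.add (hlog v hv)).sub (continuousAt_const.add (hlog u hu))

theorem logInc_zpow_mul_zpow {X : Type*} [TopologicalSpace X] {f f' : X → ℂ} {K : Set X}
    (hK : IsPreconnected K) (h : HasLog f K) (h' : HasLog f' K) {u v : X} (hu : u ∈ K)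
    (hv : v ∈ K) (a b : ℤ) : HasLog (fun z => f z ^ a * f' z ^ b) K ∧
      logInc (fun z => f z ^ a * f' z ^ b) K u v = a * logInc f K u v + b * logInc f' K u v := by
  obtain ⟨g, hg, hgf⟩ := h
  obtain ⟨g', hg', hgf'⟩ := h'
  have h1 : ContinuousOn (fun z => a * g z + b * g' z) K :=
    (continuousOn_const.mul hg).add (continuousOn_const.mul hg')
  have h2 : ∀ z ∈ K, Complex.exp (a * g z + b * g' z) = f z ^ a * f' z ^ b := fun z hz => by
    rw [Complex.exp_add, Complex.exp_int_mul, Complex.exp_int_mul, hgf z hz, hgf' z hz]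
  refine ⟨⟨_, h1, h2⟩, ?_⟩
  rw [logInc_eq hK hu hv h1 h2, logInc_eq hK hu hv hg hgf, logInc_eq hK hu hv hg' hgf']
  ring

/-- A function that has logarithms with the same increment on two sets that meet only at the ends
`u` and `v` has a logarithm on the union. -/
theorem HasLog.union_of_logInc_eq {f : Plane → ℂ} {A B : Set Plane} (hA : IsClosed A)
    (hB : IsClosed B) (hAc : IsPreconnected A) (hBc : IsPreconnected B) {u v : Plane}
    (hAB : A ∩ B = {u, v}) (h : HasLog f A) (h' : HasLog f B)
    (heq : logInc f A u v = logInc f B u v) : HasLog f (A ∪ B) := by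
  have huAB : u ∈ A ∩ B := by simp [hAB]
  have hvAB : v ∈ A ∩ B := by simp [hAB]
  obtain ⟨g, hg, hgf⟩ := h
  obtain ⟨g', hg', hgf'⟩ := h'
  rw [logInc_eq hAc huAB.1 hvAB.1 hg hgf, logInc_eq hBc huAB.2 hvAB.2 hg' hgf'] at heq
  obtain ⟨G, hG, hG1, hG2⟩ := exists_continuousOn_union_of_isClosed hA hB hg
    (g' := fun z => g' z + (g u - g' u)) (hg'.add continuousOn_const) (by
      rw [hAB]
      rintro z (rfl | rfl)
      · ring
      · linear_combination heq)
  refine ⟨G, hG, ?_⟩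
  rintro z (hz | hz)
  · rw [hG1 z hz, hgf z hz]
  · have hexp : Complex.exp (g u) = Complex.exp (g' u) := by
      rw [hgf u huAB.1, hgf' u huAB.2]
    rw [hG2 z hz, Complex.exp_add, hgf' z hz, Complex.exp_sub, hexp,
      div_self (Complex.exp_ne_zero _), mul_one]

/-- A simple closed curve, presented as the union of an arc `A` from `u` to `v` and a second
continuum `B` that meets `A` only in `u` and `v` and on which logarithms exist. -/
structure IsJordanPair (u v : Plane) (A B : Set Plane) : Prop where
  isArc : IsArc u v A
  isLogTrivial : IsLogTrivial B
  isPreconnected : IsPreconnected B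
  inter : A ∩ B = {u, v}

namespace IsJordanPair

variable {u v : Plane} {A B : Set Plane}

theorem left_mem (h : IsJordanPair u v A B) : u ∈ A ∩ B := by simp [h.inter]

theorem right_mem (h : IsJordanPair u v A B) : v ∈ A ∩ B := by simp [h.inter]

theorem isCompact (h : IsJordanPair u v A B) : IsCompact (A ∪ B) :=
  h.isArc.isCompact.union h.isLogTrivial.1

/-- The winding of the curve around `p`, as a multiple of `2πi`. -/
noncomputable def winding (_ : IsJordanPair u v A B) (p : Plane) : ℂ :=
  logInc (diffC p) A u v - logInc (diffC p) B u v

theorem exp_winding (h : IsJordanPair u v A B) {p : Plane} (hp : p ∉ A ∪ B) :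
    Complex.exp (h.winding p) = 1 := by
  rw [Set.mem_union, not_or] at hp
  rw [winding, Complex.exp_sub, exp_logInc (h.isArc.isLogTrivial.hasLog_diffC hp.1) h.left_mem.1
    h.right_mem.1, exp_logInc (h.isLogTrivial.hasLog_diffC hp.2) h.left_mem.2 h.right_mem.2]
  exact div_self (div_ne_zero (diffC_ne_zero_of_notMem hp.1 h.right_mem.1)
    (diffC_ne_zero_of_notMem hp.1 h.left_mem.1))

theorem continuousOn_winding (h : IsJordanPair u v A B) :
    ContinuousOn h.winding (A ∪ B)ᶜ := by
  intro p hp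
  rw [Set.mem_compl_iff, Set.mem_union, not_or] at hp
  exact ((continuousAt_logInc_diffC h.isArc.isClosed h.isArc.isPreconnected h.left_mem.1
    h.right_mem.1 hp.1 (h.isArc.isLogTrivial.hasLog_diffC hp.1)).sub
    (continuousAt_logInc_diffC h.isLogTrivial.1.isClosed h.isPreconnected h.left_mem.2
    h.right_mem.2 hp.2 (h.isLogTrivial.hasLog_diffC hp.2))).continuousWithinAt

theorem winding_eq_zero_of_hasLog (h : IsJordanPair u v A B) {p : Plane}
    (hp : HasLog (diffC p) (A ∪ B)) : h.winding p = 0 := by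
  obtain ⟨g, hg, hgf⟩ := hp
  rw [winding, logInc_eq h.isArc.isPreconnected h.left_mem.1 h.right_mem.1
    (hg.mono Set.subset_union_left) fun z hz => hgf z (Or.inl hz),
    logInc_eq h.isPreconnected h.left_mem.2 h.right_mem.2
    (hg.mono Set.subset_union_right) fun z hz => hgf z (Or.inr hz), sub_self]

theorem winding_eq_zero (h : IsJordanPair u v A B) {p : Plane} (hp : p ∈ outer (A ∪ B)) :
    h.winding p = 0 :=
  h.winding_eq_zero_of_hasLog (hasLog_diffC_of_mem_outer h.isCompact hp)

theorem winding_ne_zero (h : IsJordanPair u v A B) {p : Plane} (hp : p ∈ inner (A ∪ B)) :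
    h.winding p ≠ 0 := by
  intro h0
  have hp' := hp.1
  rw [Set.mem_union, not_or] at hp'
  refine notMem_inner_of_hasLog h.isCompact ?_ hp
  exact HasLog.union_of_logInc_eq h.isArc.isClosed h.isLogTrivial.1.isClosed
    h.isArc.isPreconnected h.isPreconnected h.inter
    (h.isArc.isLogTrivial.hasLog_diffC hp'.1) (h.isLogTrivial.hasLog_diffC hp'.2) (sub_eq_zero.1 h0)

/-- There is at most one bounded component: the first cohomology of the curve has rank one, and
points of different bounded components are independent there. -/
theorem mem_connectedComponentIn (h : IsJordanPair u v A B) {p q : Plane}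
    (hp : p ∈ inner (A ∪ B)) (hq : q ∈ inner (A ∪ B)) :
    q ∈ connectedComponentIn (A ∪ B)ᶜ p := by
  by_contra hpq
  obtain ⟨a, ha⟩ := Complex.exp_eq_one_iff.1 (h.exp_winding hp.1)
  obtain ⟨b, hb⟩ := Complex.exp_eq_one_iff.1 (h.exp_winding hq.1)
  have hp' := hp.1
  have hq' := hq.1
  rw [Set.mem_union, not_or] at hp' hq'
  -- for windings `a` and `b`, the winding of `(z - p) ^ b * (z - q) ^ (-a)` is zero
  obtain ⟨h1, h1'⟩ := logInc_zpow_mul_zpow h.isArc.isPreconnected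
    (h.isArc.isLogTrivial.hasLog_diffC hp'.1) (h.isArc.isLogTrivial.hasLog_diffC hq'.1)
    h.left_mem.1 h.right_mem.1 b (-a)
  obtain ⟨h2, h2'⟩ := logInc_zpow_mul_zpow h.isPreconnected
    (h.isLogTrivial.hasLog_diffC hp'.2) (h.isLogTrivial.hasLog_diffC hq'.2)
    h.left_mem.2 h.right_mem.2 b (-a)
  have hb0 := eq_zero_of_hasLog h.isCompact hp hq.1 hpq
    (HasLog.union_of_logInc_eq h.isArc.isClosed h.isLogTrivial.1.isClosed
      h.isArc.isPreconnected h.isPreconnected h.inter h1 h2 (by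
        rw [h1', h2']
        unfold winding at ha hb
        push_cast
        linear_combination (b : ℂ) * ha - a * hb))
  refine h.winding_ne_zero hq ?_
  rw [hb, hb0]
  simp

theorem isPreconnected_inner (h : IsJordanPair u v A B) : IsPreconnected (inner (A ∪ B)) := by
  rcases (inner (A ∪ B)).eq_empty_or_nonempty with he | ⟨p, hp⟩
  · rw [he]
    exact isPreconnected_empty
  have : inner (A ∪ B) = connectedComponentIn (A ∪ B)ᶜ p := by
    refine Set.Subset.antisymm (fun q hq => h.mem_connectedComponentIn hp hq) fun q hq => ?_
    refine ⟨connectedComponentIn_subset _ _ hq, ?_⟩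
    rw [← connectedComponentIn_eq hq]
    exact hp.2
  rw [this]
  exact isPreconnected_connectedComponentIn

/-- The windings around the points off the curve have no common divisor `M ≥ 2`: otherwise an
`M`-th root of `(v - p) / (u - p)`, as a function of `p`, would exist off `u` and `v`. -/
theorem not_forall_dvd_winding (h : IsJordanPair u v A B) {M : ℕ} (hM : 2 ≤ M) :
    ¬ ∀ p ∉ A ∪ B, ∃ j : ℤ, h.winding p = M * j * (2 * Real.pi * Complex.I) := by
  intro hdvd
  have hM0 : (M : ℂ) ≠ 0 := by
    norm_cast
    omega
  have hcont : ∀ K : Set Plane, IsLogTrivial K → IsPreconnected K → u ∈ K → v ∈ K →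
      ContinuousOn (fun p => Complex.exp (logInc (diffC p) K u v / M)) Kᶜ :=
    fun K hK hKc hu hv p hp => ((continuousAt_logInc_diffC hK.1.isClosed hKc hu hv hp
      (hK.hasLog_diffC hp)).div_const _).cexp.continuousWithinAt
  -- the roots defined by logarithms on `A` and on `B` agree off the curve, by divisibility
  obtain ⟨F, hF, hFA, hFB⟩ := exists_continuousOn_union_of_isOpen
    h.isArc.isClosed.isOpen_compl h.isLogTrivial.1.isClosed.isOpen_compl
    (hcont A h.isArc.isLogTrivial h.isArc.isPreconnected h.left_mem.1 h.right_mem.1)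
    (hcont B h.isLogTrivial h.isPreconnected h.left_mem.2 h.right_mem.2) (by
      rintro p ⟨hpA, hpB⟩
      obtain ⟨j, hj⟩ := hdvd p (by
        rw [Set.mem_union, not_or]
        exact ⟨hpA, hpB⟩)
      refine Complex.exp_eq_exp_iff_exists_int.2 ⟨j, ?_⟩
      unfold winding at hj
      field_simp
      linear_combination hj)
  have hpow : ∀ K : Set Plane, IsLogTrivial K → u ∈ K → v ∈ K → ∀ p ∉ K,
      Complex.exp (logInc (diffC p) K u v / M) ^ M * diffC u p = diffC v p := by
    intro K hK hu hv p hp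
    have hne := diffC_ne_zero_of_notMem hp hu
    rw [← Complex.exp_nat_mul, mul_div_cancel₀ _ hM0, exp_logInc (hK.hasLog_diffC hp) hu hv]
    field_simp
    simp only [diffC]
    ring
  have huv : 0 < dist u v := dist_pos.2 h.isArc.ne
  have hsub : ∀ z ∈ Metric.sphere u (dist u v / 2), z ∈ Aᶜ ∪ Bᶜ := by
    intro z hz
    rw [← Set.compl_inter, h.inter]
    rw [Metric.mem_sphere] at hz
    rintro (rfl | hzv)
    · rw [dist_self] at hz
      linarith
    · rw [Set.mem_singleton_iff.1 hzv, dist_comm] at hz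
      linarith
  -- around a small circle with centre `u`, the factor `v - p` has winding zero and `u - p` has
  -- winding one, which is not divisible by `M`
  have hlog : HasLog (diffC v) (Metric.sphere u (dist u v / 2)) := by
    have huv0 : diffC v u ≠ 0 := diffC_ne_zero h.isArc.ne
    refine ((hasLog_one_add (f := fun z => diffC u z / diffC v u) (by fun_prop)
      fun z hz => ?_).mul (hasLog_const huv0 _)).congr fun z hz => ?_
    · rw [Metric.mem_sphere] at hz
      rw [norm_div, norm_diffC, norm_diffC, hz, div_lt_one huv]
      linarith
    · field_simp
      simp only [diffC]
      ring
  have hdiv := dvd_of_hasLog_sphere (p := u) (r := dist u v / 2) (by linarith) (hF.mono hsub)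
    (fun z hz => by
      rcases hsub z hz with h1 | h1
      · rw [hFA z h1]
        exact Complex.exp_ne_zero _
      · rw [hFB z h1]
        exact Complex.exp_ne_zero _) (M := M) (n := 1)
    (hlog.congr fun z hz => by
      rw [zpow_one]
      rcases hsub z hz with h1 | h1
      · rw [hFA z h1, hpow A h.isArc.isLogTrivial h.left_mem.1 h.right_mem.1 z h1]
      · rw [hFB z h1, hpow B h.isLogTrivial h.left_mem.2 h.right_mem.2 z h1])
  have : (M : ℤ) ≤ 1 := Int.le_of_dvd one_pos hdiv
  omega

/-- The winding number is `1` inside, or `-1` inside. -/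
theorem exists_winding_eq (h : IsJordanPair u v A B) : (inner (A ∪ B)).Nonempty ∧
    ∃ N : ℤ, (N = 1 ∨ N = -1) ∧
      ∀ p ∈ inner (A ∪ B), h.winding p = N * (2 * Real.pi * Complex.I) := by
  have hne : (inner (A ∪ B)).Nonempty := by
    by_contra hcon
    refine h.not_forall_dvd_winding le_rfl fun p hp => ⟨0, ?_⟩
    rcases mem_inner_or_mem_outer hp with h1 | h1
    · exact absurd ⟨p, h1⟩ hcon
    · simp [h.winding_eq_zero h1]
  refine ⟨hne, ?_⟩
  obtain ⟨p₀, hp₀⟩ := hne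
  obtain ⟨N, hN⟩ := Complex.exp_eq_one_iff.1 (h.exp_winding hp₀.1)
  have hconst : ∀ p ∈ inner (A ∪ B), h.winding p = N * (2 * Real.pi * Complex.I) := fun p hp => by
    rw [← hN]
    exact h.isPreconnected_inner.constant_of_mapsTo isDiscrete_exp_eq_one
      (h.continuousOn_winding.mono fun q hq => hq.1) (fun q hq => h.exp_winding hq.1) hp hp₀
  refine ⟨N, ?_, hconst⟩
  by_contra hcon
  have hN0 : N ≠ 0 := by
    rintro rfl
    exact h.winding_ne_zero hp₀ (by simp [hN])
  refine h.not_forall_dvd_winding (M := N.natAbs) (by omega) fun p hp => ?_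
  rcases mem_inner_or_mem_outer hp with h1 | h1
  · rcases Int.natAbs_eq N with h2 | h2
    · exact ⟨1, by
        rw [hconst p h1]
        congr 1
        rw [Int.cast_one, mul_one, ← Int.cast_natCast (R := ℂ), ← h2]⟩
    · exact ⟨-1, by
        rw [hconst p h1]
        congr 1
        rw [Int.cast_neg, Int.cast_one, mul_neg, mul_one, ← Int.cast_natCast (R := ℂ),
          ← Int.cast_neg, ← h2]⟩
  · exact ⟨0, by simp [h.winding_eq_zero h1]⟩

theorem outer_nonempty (h : IsJordanPair u v A B) : (outer (A ∪ B)).Nonempty := by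
  by_contra hcon
  rw [Set.not_nonempty_iff_eq_empty] at hcon
  exact not_isBounded_outer h.isCompact (by simp [hcon])

/-- Every point of the arc is a limit of points of a given component of the complement, because the
rest of the curve does not separate the plane. -/
theorem arc_subset_closure (h : IsJordanPair u v A B) {S S' : Set Plane} (hS : IsOpen S)
    (hS' : IsOpen S') (hne : S.Nonempty) (hne' : S'.Nonempty) (hdisj : Disjoint S S')
    (hSJ : S ∪ S' = (A ∪ B)ᶜ) : A ⊆ closure S := by
  refine h.isArc.subset_closure_diff.trans (closure_minimal ?_ isClosed_closure)
  intro x hx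
  by_contra hxS
  obtain ⟨A₁, A₂, hA₁, hA₂, hsub₁, hsub₂, hcov, hu, hv, hd⟩ := h.isArc.exists_split hx
    isClosed_closure.isOpen_compl hxS
  have hd' := Set.disjoint_left.1 hd
  have hint₁ : (A₁ ∩ B).Subsingleton := by
    refine Set.subsingleton_singleton.anti (t := {u}) ?_
    rintro z ⟨hz, hzB⟩
    have : z ∈ A ∩ B := ⟨hsub₁ hz, hzB⟩
    rw [h.inter] at this
    rcases this with h1 | h1
    · exact h1
    · rw [Set.mem_singleton_iff.1 h1] at hz
      exact absurd hv (hd' hz)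
  have hint₂ : ((A₁ ∪ B) ∩ A₂).Subsingleton := by
    refine Set.subsingleton_singleton.anti (t := {v}) ?_
    rintro z ⟨hz | hz, hz₂⟩
    · exact absurd hz₂ (hd' hz)
    · have : z ∈ A ∩ B := ⟨hsub₂ hz₂, hz⟩
      rw [h.inter] at this
      rcases this with h1 | h1
      · rw [h1] at hz₂
        exact absurd hz₂ (hd' hu)
      · exact h1
  have hK := (hA₁.union h.isLogTrivial hint₁.isPreconnected).union hA₂ hint₂.isPreconnected
  have hKJ : A₁ ∪ B ∪ A₂ ⊆ A ∪ B := by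
    rintro z ((hz | hz) | hz)
    exacts [Or.inl (hsub₁ hz), Or.inr hz, Or.inl (hsub₂ hz)]
  have hSc : S ⊆ (A ∪ B)ᶜ := hSJ ▸ Set.subset_union_left
  have hSc' : S' ⊆ (A ∪ B)ᶜ := hSJ ▸ Set.subset_union_right
  have hall := compl_subset_of_frontier_subset hK.1 (fun p hp => hK.hasLog_diffC hp) hS
    (by
      intro z hz
      by_cases hzJ : z ∈ A ∪ B
      · right
        rcases hzJ with h1 | h1
        · rcases hcov ⟨h1, fun hn => hn hz⟩ with h2 | h2
          · exact Or.inl (Or.inl h2)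
          · exact Or.inr h2
        · exact Or.inl (Or.inr h1)
      · left
        have : z ∈ S ∪ S' := hSJ ▸ hzJ
        rcases this with h1 | h1
        · exact h1
        · obtain ⟨y, hy, hy'⟩ := mem_closure_iff.1 hz S' hS' h1
          exact absurd hy (Set.disjoint_left.1 hdisj hy'))
    (by
      obtain ⟨y, hy⟩ := hne
      exact ⟨y, hy, fun hyK => hSc hy (hKJ hyK)⟩)
  obtain ⟨y, hy⟩ := hne'
  exact Set.disjoint_left.1 hdisj (hall fun hyK => hSc' hy (hKJ hyK)) hy

theorem inner_union_outer (K : Set Plane) : inner K ∪ outer K = Kᶜ := by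
  ext p
  exact ⟨fun hp => hp.elim (fun h => h.1) fun h => h.1, fun hp => mem_inner_or_mem_outer hp⟩

theorem arc_subset_closure_inner (h : IsJordanPair u v A B) : A ⊆ closure (inner (A ∪ B)) :=
  h.arc_subset_closure (isOpen_inner h.isCompact.isClosed) (isOpen_outer h.isCompact.isClosed)
    h.exists_winding_eq.1 h.outer_nonempty (disjoint_inner_outer _) (inner_union_outer _)

theorem arc_subset_closure_outer (h : IsJordanPair u v A B) : A ⊆ closure (outer (A ∪ B)) :=
  h.arc_subset_closure (isOpen_outer h.isCompact.isClosed) (isOpen_inner h.isCompact.isClosed)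
    h.outer_nonempty h.exists_winding_eq.1 (disjoint_inner_outer _).symm
    (by rw [Set.union_comm, inner_union_outer])

end IsJordanPair

/-! ### Paths and cycles of a plane graph -/

namespace PlaneDrawing

variable {V : Type*} {G : SimpleGraph V} (D : PlaneDrawing G)

theorem isArc_of_adj {u v : V} (h : G.Adj u v) : IsArc (D.point u) (D.point v) (D.arc s(u, v)) :=
  D.isArc u v h

/-- The points covered by a walk. -/
def walkCarrier : {u v : V} → G.Walk u v → Set Plane
  | u, _, .nil => {D.point u}
  | u, _, .cons (v := v) _ p => D.arc s(u, v) ∪ walkCarrier p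

/-- The sum of the increments of logarithms of `f` along the edges of a walk. -/
noncomputable def walkLog (f : Plane → ℂ) : {u v : V} → G.Walk u v → ℂ
  | _, _, .nil => 0
  | u, _, .cons (v := v) _ p => logInc f (D.arc s(u, v)) (D.point u) (D.point v) + walkLog f p

theorem mem_walkCarrier {u v : V} (p : G.Walk u v) {z : Plane} :
    z ∈ D.walkCarrier p ↔ z = D.point v ∨ ∃ e ∈ p.edges, z ∈ D.arc e := by
  induction p with
  | nil => simp [walkCarrier]
  | cons h p ih =>
    simp only [walkCarrier, Set.mem_union, ih, SimpleGraph.Walk.edges_cons, List.mem_cons,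
      exists_eq_or_imp]
    tauto

theorem start_mem_walkCarrier {u v : V} (p : G.Walk u v) : D.point u ∈ D.walkCarrier p := by
  cases p with
  | nil => simp [walkCarrier]
  | cons h p => exact Or.inl (D.isArc_of_adj h).left_mem

theorem end_mem_walkCarrier {u v : V} (p : G.Walk u v) : D.point v ∈ D.walkCarrier p :=
  (D.mem_walkCarrier p).2 (Or.inl rfl)

theorem exists_of_mem_arc_of_mem_walkCarrier {u v : V} (p : G.Walk u v) {e : Sym2 V}
    (he : e ∈ G.edgeSet) (hep : e ∉ p.edges) {z : Plane} (hz : z ∈ D.arc e)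
    (hzp : z ∈ D.walkCarrier p) : ∃ x ∈ e, x ∈ p.support ∧ D.point x = z := by
  rcases (D.mem_walkCarrier p).1 hzp with rfl | ⟨e', he', hz'⟩
  · exact ⟨v, D.mem_of_point_mem_arc e he v hz, p.end_mem_support, rfl⟩
  · have heG := p.edges_subset_edgeSet he'
    obtain ⟨x, hx, rfl⟩ := D.arc_inter_arc e he e' heG
      (fun h => hep (h ▸ he')) z ⟨hz, hz'⟩
    exact ⟨x, hx, p.mem_support_of_mem_edges he' (D.mem_of_point_mem_arc e' heG x hz'), rfl⟩

theorem isLogTrivial_walkCarrier {u v : V} (p : G.Walk u v) (hp : p.IsPath) :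
    IsLogTrivial (D.walkCarrier p) ∧ IsPreconnected (D.walkCarrier p) := by
  induction p with
  | nil => exact ⟨isLogTrivial_singleton _, isPreconnected_singleton⟩
  | @cons u v w h p ih =>
    rw [SimpleGraph.Walk.cons_isPath_iff] at hp
    obtain ⟨ih1, ih2⟩ := ih hp.1
    have harc := D.isArc_of_adj h
    refine ⟨harc.isLogTrivial.union ih1 (Set.Subsingleton.isPreconnected ?_),
      harc.isPreconnected.union _ harc.right_mem (D.start_mem_walkCarrier p) ih2⟩
    refine Set.subsingleton_singleton.anti (t := {D.point v}) ?_
    rintro z ⟨hz, hzp⟩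
    obtain ⟨x, hx, hxp, rfl⟩ := D.exists_of_mem_arc_of_mem_walkCarrier p h
      (fun he => hp.2 (p.fst_mem_support_of_mem_edges he)) hz hzp
    rcases Sym2.mem_iff.1 hx with rfl | rfl
    · exact absurd hxp hp.2
    · rfl

theorem logInc_walkCarrier {f : Plane → ℂ} {u v : V} (p : G.Walk u v) (hp : p.IsPath)
    (hf : HasLog f (D.walkCarrier p)) :
    logInc f (D.walkCarrier p) (D.point u) (D.point v) = D.walkLog f p := by
  induction p with
  | nil => simp [walkLog, logInc]
  | cons h p ih =>
    rw [SimpleGraph.Walk.cons_isPath_iff] at hp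
    rw [walkLog, ← ih hp.1 (hf.mono Set.subset_union_right)]
    exact logInc_union (D.isArc_of_adj h).isPreconnected (D.isLogTrivial_walkCarrier p hp.1).2 hf
      (D.isArc_of_adj h).left_mem (D.isArc_of_adj h).right_mem (D.start_mem_walkCarrier p)
      (D.end_mem_walkCarrier p)

/-- A path together with an edge that joins its ends is a simple closed curve. -/
theorem isJordanPair {u v : V} (h : G.Adj u v) (p : G.Walk u v) (hp : p.IsPath)
    (hep : s(u, v) ∉ p.edges) :
    IsJordanPair (D.point u) (D.point v) (D.arc s(u, v)) (D.walkCarrier p) where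
  isArc := D.isArc_of_adj h
  isLogTrivial := (D.isLogTrivial_walkCarrier p hp).1
  isPreconnected := (D.isLogTrivial_walkCarrier p hp).2
  inter := by
    refine Set.Subset.antisymm ?_ ?_
    · rintro z ⟨hz, hzp⟩
      obtain ⟨x, hx, hxp, rfl⟩ := D.exists_of_mem_arc_of_mem_walkCarrier p h hep hz hzp
      rcases Sym2.mem_iff.1 hx with rfl | rfl <;> simp
    · rintro z (rfl | rfl)
      · exact ⟨(D.isArc_of_adj h).left_mem, D.start_mem_walkCarrier p⟩
      · exact ⟨(D.isArc_of_adj h).right_mem, D.end_mem_walkCarrier p⟩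

theorem winding_isJordanPair {u v : V} (h : G.Adj u v) (p : G.Walk u v) (hp : p.IsPath)
    (hep : s(u, v) ∉ p.edges) {q : Plane} (hq : q ∉ D.walkCarrier p) :
    (D.isJordanPair h p hp hep).winding q =
      logInc (diffC q) (D.arc s(u, v)) (D.point u) (D.point v) - D.walkLog (diffC q) p := by
  rw [IsJordanPair.winding, D.logInc_walkCarrier p hp
    ((D.isLogTrivial_walkCarrier p hp).1.hasLog_diffC hq)]

end PlaneDrawing

/-! ### The number of edges of a triangle-free plane graph -/

section CycleSpace

variable {V : Type*} {G : SimpleGraph V}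

/-- The first end of an edge, for an arbitrary fixed orientation of the edges. -/
noncomputable def edgeSrc (e : G.edgeSet) : V := (e : Sym2 V).out.1

/-- The second end of an edge, for an arbitrary fixed orientation of the edges. -/
noncomputable def edgeTgt (e : G.edgeSet) : V := (e : Sym2 V).out.2

theorem mk_edgeSrc_edgeTgt (e : G.edgeSet) : s(edgeSrc e, edgeTgt e) = (e : Sym2 V) :=
  Quot.out_eq _

theorem adj_edgeSrc_edgeTgt (e : G.edgeSet) : G.Adj (edgeSrc e) (edgeTgt e) := by
  rw [← SimpleGraph.mem_edgeSet, mk_edgeSrc_edgeTgt]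
  exact e.2

/-- An edge that is not a bridge closes a cycle. -/
theorem exists_isPath_of_not_isBridge {e : G.edgeSet} (he : ¬ G.IsBridge e) :
    ∃ p : G.Walk (edgeSrc e) (edgeTgt e), p.IsPath ∧ (e : Sym2 V) ∉ p.edges := by
  classical
  rw [← mk_edgeSrc_edgeTgt e, SimpleGraph.isBridge_iff_forall_walk_mem_edges] at he
  push Not at he
  obtain ⟨p, hp⟩ := he
  refine ⟨p.bypass, p.bypass_isPath, fun h => hp ?_⟩
  rw [mk_edgeSrc_edgeTgt]
  exact p.edges_bypass_subset_edges h

open Classical in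
/-- The `1`-chain of an edge with the orientation from `u` to `v`. -/
noncomputable def dartChain (u v : V) : G.edgeSet → ℂ := fun e =>
  if (e : Sym2 V) = s(u, v) then if edgeSrc e = u then 1 else -1 else 0

/-- The `1`-chain of a walk. -/
noncomputable def walkChain : {u v : V} → G.Walk u v → G.edgeSet → ℂ
  | _, _, .nil => 0
  | u, _, .cons (v := v) _ p => dartChain u v + walkChain p

theorem walkChain_eq_zero {u v : V} (p : G.Walk u v) {e : G.edgeSet} (he : (e : Sym2 V) ∉ p.edges) :
    walkChain p e = 0 := by
  induction p with
  | nil => rfl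
  | cons h p ih =>
    rw [SimpleGraph.Walk.edges_cons, List.mem_cons, not_or] at he
    simp [walkChain, ih he.2, dartChain, he.1]

variable [Fintype G.edgeSet]

/-- The boundary of a `1`-chain of the graph, as a functional on the functions on the vertices. -/
noncomputable def boundary (G : SimpleGraph V) [Fintype G.edgeSet] :
    (G.edgeSet → ℂ) →ₗ[ℂ] Module.Dual ℂ (V → ℂ) :=
  LinearMap.mk₂ ℂ (fun φ A => ∑ e, φ e * (A (edgeTgt e) - A (edgeSrc e)))
    (fun φ φ' A => by simp [add_mul, Finset.sum_add_distrib])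
    (fun c φ A => by simp [mul_assoc, Finset.mul_sum])
    (fun φ A A' => by
      rw [← Finset.sum_add_distrib]
      refine Finset.sum_congr rfl fun e _ => ?_
      simp only [Pi.add_apply]
      ring)
    (fun c φ A => by
      rw [smul_eq_mul, Finset.mul_sum]
      refine Finset.sum_congr rfl fun e _ => ?_
      simp only [Pi.smul_apply, smul_eq_mul]
      ring)

/-- The cycle space of the graph, with complex coefficients. -/
noncomputable def cycleSpace (G : SimpleGraph V) [Fintype G.edgeSet] :
    Submodule ℂ (G.edgeSet → ℂ) :=
  LinearMap.ker (boundary G)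

theorem mem_cycleSpace {φ : G.edgeSet → ℂ} :
    φ ∈ cycleSpace G ↔ ∀ A : V → ℂ, ∑ e, φ e * (A (edgeTgt e) - A (edgeSrc e)) = 0 := by
  rw [cycleSpace, LinearMap.mem_ker, LinearMap.ext_iff]
  rfl

theorem card_edgeSet_le_finrank_cycleSpace [Fintype V] :
    Fintype.card G.edgeSet ≤ Fintype.card V + Module.finrank ℂ (cycleSpace G) := by
  have h := LinearMap.finrank_range_add_finrank_ker (boundary G)
  have h2 := Submodule.finrank_le (LinearMap.range (boundary G))
  rw [Subspace.dual_finrank_eq, Module.finrank_fintype_fun_eq_card] at h2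
  rw [Module.finrank_fintype_fun_eq_card] at h
  have h3 : Module.finrank ℂ (cycleSpace G) = Module.finrank ℂ (LinearMap.ker (boundary G)) := rfl
  omega

theorem sum_dartChain {u v : V} (h : G.Adj u v) {f : V → V → ℂ} (hf : ∀ a b, f a b = -f b a) :
    ∑ e : G.edgeSet, dartChain u v e * f (edgeSrc e) (edgeTgt e) = f u v := by
  rw [Finset.sum_eq_single ⟨s(u, v), h⟩]
  · have hmk := mk_edgeSrc_edgeTgt (⟨s(u, v), h⟩ : G.edgeSet)
    rcases Sym2.eq_iff.1 hmk with ⟨h1, h2⟩ | ⟨h1, h2⟩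
    · simp [dartChain, h1, h2]
    · simp only [dartChain, h1, h2, if_true, h.ne', if_false]
      rw [hf u v]
      ring
  · intro e _ he
    have : (e : Sym2 V) ≠ s(u, v) := fun h' => he (Subtype.ext h')
    simp [dartChain, this]
  · simp

theorem sum_walkChain_sub {u v : V} (p : G.Walk u v) (A : V → ℂ) :
    ∑ e, walkChain p e * (A (edgeTgt e) - A (edgeSrc e)) = A v - A u := by
  induction p with
  | nil => simp [walkChain]
  | @cons u v w h p ih =>
    simp only [walkChain, Pi.add_apply, add_mul, Finset.sum_add_distrib, ih]
    rw [sum_dartChain h (f := fun a b => A b - A a) (fun a b => by ring)]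
    ring

theorem sum_walkChain_logInc (D : PlaneDrawing G) (f : Plane → ℂ) {u v : V} (p : G.Walk u v) :
    ∑ e : G.edgeSet, walkChain p e * logInc f (D.arc e) (D.point (edgeSrc e))
      (D.point (edgeTgt e)) = D.walkLog f p := by
  induction p with
  | nil => simp [walkChain, PlaneDrawing.walkLog]
  | cons h p ih =>
    simp only [walkChain, Pi.add_apply, add_mul, Finset.sum_add_distrib, ih, PlaneDrawing.walkLog]
    congr 1
    have := sum_dartChain h
      (f := fun a b => logInc f (D.arc s(a, b)) (D.point a) (D.point b)) (fun a b => by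
        rw [logInc_symm, Sym2.eq_swap])
    simpa only [mk_edgeSrc_edgeTgt] using this

/-- A chain in the cycle space does not use bridges. -/
theorem eq_zero_of_isBridge {φ : G.edgeSet → ℂ} (hφ : φ ∈ cycleSpace G) {e : G.edgeSet}
    (he : G.IsBridge e) : φ e = 0 := by
  classical
  -- test the boundary on the indicator function of one side of the bridge
  have hsum := mem_cycleSpace.1 hφ fun v =>
    if (G.deleteEdges {(e : Sym2 V)}).Reachable (edgeSrc e) v then 1 else 0
  rw [← mk_edgeSrc_edgeTgt e, SimpleGraph.isBridge_iff, mk_edgeSrc_edgeTgt] at he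
  rw [Finset.sum_eq_single e] at hsum
  · simpa [he] using hsum
  · intro e' _ hne
    have hadj : (G.deleteEdges {(e : Sym2 V)}).Adj (edgeSrc e') (edgeTgt e') := by
      rw [SimpleGraph.deleteEdges_adj, mk_edgeSrc_edgeTgt]
      exact ⟨adj_edgeSrc_edgeTgt e', fun h => hne (Subtype.ext h)⟩
    have : (G.deleteEdges {(e : Sym2 V)}).Reachable (edgeSrc e) (edgeSrc e') ↔
        (G.deleteEdges {(e : Sym2 V)}).Reachable (edgeSrc e) (edgeTgt e') :=
      ⟨fun h => h.trans hadj.reachable, fun h => h.trans hadj.symm.reachable⟩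
    simp [this]
  · simp

end CycleSpace

namespace PlaneDrawing

variable {V : Type*} {G : SimpleGraph V} (D : PlaneDrawing G)

/-- The points covered by a set of edges. -/
def edgesCarrier (S : Set (Sym2 V)) : Set Plane := ⋃ e ∈ S, D.arc e

variable {D} in
theorem mem_edgesCarrier {S : Set (Sym2 V)} {z : Plane} :
    z ∈ D.edgesCarrier S ↔ ∃ e ∈ S, z ∈ D.arc e := by
  simp [edgesCarrier]

theorem arc_subset_edgesCarrier {S : Set (Sym2 V)} {e : Sym2 V} (he : e ∈ S) :
    D.arc e ⊆ D.edgesCarrier S :=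
  Set.subset_biUnion_of_mem (u := D.arc) he

theorem isArc_edge (e : G.edgeSet) :
    IsArc (D.point (edgeSrc e)) (D.point (edgeTgt e)) (D.arc e) := by
  have := D.isArc_of_adj (adj_edgeSrc_edgeTgt e)
  rwa [mk_edgeSrc_edgeTgt] at this

theorem isCompact_edgesCarrier {S : Set (Sym2 V)} (hS : S.Finite) (hSG : S ⊆ G.edgeSet) :
    IsCompact (D.edgesCarrier S) :=
  hS.isCompact_biUnion fun e he => (D.isArc_edge ⟨e, hSG he⟩).isCompact

/-- A point of two different edges is a common end. -/
theorem exists_mem_of_mem_arc {e e' : Sym2 V} (he : e ∈ G.edgeSet) (he' : e' ∈ G.edgeSet)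
    (hne : e ≠ e') {z : Plane} (hz : z ∈ D.arc e) (hz' : z ∈ D.arc e') :
    ∃ x, x ∈ e ∧ x ∈ e' ∧ D.point x = z := by
  obtain ⟨x, hx, rfl⟩ := D.arc_inter_arc e he e' he' hne z ⟨hz, hz'⟩
  exact ⟨x, hx, D.mem_of_point_mem_arc e' he' x hz', rfl⟩

/-- All logarithms exist on a drawing of a forest. -/
theorem isLogTrivial_edgesCarrier_of_isAcyclic {S : Set (Sym2 V)} (hS : S.Finite)
    (hSG : S ⊆ G.edgeSet) (hac : (SimpleGraph.fromEdgeSet S).IsAcyclic) :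
    IsLogTrivial (D.edgesCarrier S) := by
  induction hn : S.ncard using Nat.strong_induction_on generalizing S with
  | _ n ih =>
  rcases S.eq_empty_or_nonempty with rfl | ⟨e, he⟩
  · simpa [edgesCarrier] using isLogTrivial_empty
  induction e with | _ a b =>
  have hab : G.Adj a b := hSG he
  have hbridge := SimpleGraph.isAcyclic_iff_forall_isBridge.1 hac (e := s(a, b))
    (by simp [he, hab.ne])
  rw [SimpleGraph.isBridge_iff] at hbridge
  set R := (SimpleGraph.fromEdgeSet S).deleteEdges {s(a, b)} with hR
  -- the edges of the component of `a`, and the edges of the other components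
  let S₁ : Set (Sym2 V) := {e ∈ S | e ≠ s(a, b) ∧ ∃ x ∈ e, R.Reachable a x}
  let S₂ : Set (Sym2 V) := {e ∈ S | e ≠ s(a, b) ∧ ¬ ∃ x ∈ e, R.Reachable a x}
  have hRadj : ∀ x y, s(x, y) ∈ S → s(x, y) ≠ s(a, b) → R.Adj x y := fun x y h1 h2 => by
    rw [hR, SimpleGraph.deleteEdges_adj, SimpleGraph.fromEdgeSet_adj]
    exact ⟨⟨h1, (hSG h1 : G.Adj x y).ne⟩, h2⟩
  have hreach : ∀ e ∈ S₁, ∀ y ∈ e, R.Reachable a y := by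
    intro e he y hy
    obtain ⟨heS, hne, x, hx, hax⟩ := he
    by_cases hxy : x = y
    · exact hxy ▸ hax
    · have : e = s(x, y) := (Sym2.mem_and_mem_iff hxy).1 ⟨hx, hy⟩
      subst this
      exact hax.trans (hRadj x y heS hne).reachable
  have hlt : ∀ T ⊆ S, s(a, b) ∉ T → IsLogTrivial (D.edgesCarrier T) := fun T hT hnot =>
    ih T.ncard (hn ▸ Set.ncard_lt_ncard ⟨hT, fun h => hnot (h he)⟩ hS) (hS.subset hT)
      (hT.trans hSG) (hac.anti (SimpleGraph.fromEdgeSet_mono hT)) rfl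
  have h₁ := hlt S₁ (fun e he => he.1) fun h => h.2.1 rfl
  have h₂ := hlt S₂ (fun e he => he.1) fun h => h.2.1 rfl
  have harc : IsLogTrivial (D.arc s(a, b)) := (D.isArc_of_adj hab).isLogTrivial
  have hunion : D.edgesCarrier S = D.edgesCarrier S₁ ∪ D.arc s(a, b) ∪ D.edgesCarrier S₂ := by
    ext z
    simp only [Set.mem_union, mem_edgesCarrier]
    constructor
    · rintro ⟨e, heS, hz⟩
      by_cases h1 : e = s(a, b)
      · exact Or.inl (Or.inr (h1 ▸ hz))
      by_cases h2 : ∃ x ∈ e, R.Reachable a x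
      · exact Or.inl (Or.inl ⟨e, ⟨heS, h1, h2⟩, hz⟩)
      · exact Or.inr ⟨e, ⟨heS, h1, h2⟩, hz⟩
    · rintro ((⟨e, h, hz⟩ | hz) | ⟨e, h, hz⟩)
      exacts [⟨e, h.1, hz⟩, ⟨_, he, hz⟩, ⟨e, h.1, hz⟩]
  rw [hunion]
  refine (h₁.union harc (Set.Subsingleton.isPreconnected ?_)).union h₂
    (Set.Subsingleton.isPreconnected ?_)
  · refine Set.subsingleton_singleton.anti (t := {D.point a}) ?_
    rintro z ⟨hz, hz'⟩
    obtain ⟨e', he', hz⟩ := mem_edgesCarrier.1 hz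
    obtain ⟨x, hx, hx', rfl⟩ := D.exists_mem_of_mem_arc hab (hSG he'.1) he'.2.1.symm hz' hz
    rcases Sym2.mem_iff.1 hx with rfl | rfl
    · rfl
    · exact absurd (hreach e' he' x hx') hbridge
  · refine Set.subsingleton_singleton.anti (t := {D.point b}) ?_
    rintro z ⟨hz | hz, hz'⟩
    · obtain ⟨e₂, he₂, hz₂⟩ := mem_edgesCarrier.1 hz'
      obtain ⟨e₁, he₁, hz₁⟩ := mem_edgesCarrier.1 hz
      obtain ⟨x, hx, hx', rfl⟩ := D.exists_mem_of_mem_arc (hSG he₁.1) (hSG he₂.1)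
        (fun h => he₂.2.2 (h ▸ he₁.2.2)) hz₁ hz₂
      exact absurd ⟨x, hx', hreach e₁ he₁ x hx⟩ he₂.2.2
    · obtain ⟨e', he', hz'⟩ := mem_edgesCarrier.1 hz'
      obtain ⟨x, hx, hx', rfl⟩ := D.exists_mem_of_mem_arc hab (hSG he'.1) he'.2.1.symm hz hz'
      rcases Sym2.mem_iff.1 hx with rfl | rfl
      · exact absurd ⟨x, hx', SimpleGraph.Reachable.refl x⟩ he'.2.2
      · rfl

end PlaneDrawing

theorem logInc_sub_eq {X : Type*} [TopologicalSpace X] {f f' g : X → ℂ} {K : Set X}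
    (hK : IsPreconnected K) {u v : X} (hu : u ∈ K) (hv : v ∈ K) (hg : ContinuousOn g K)
    (hgf : ∀ z ∈ K, Complex.exp (g z) = f z / f' z) (h0 : ∀ z ∈ K, f' z ≠ 0) (h : HasLog f' K) :
    logInc f K u v - logInc f' K u v = g v - g u := by
  obtain ⟨g', hg', hgf'⟩ := h
  rw [logInc_eq hK hu hv hg' hgf', logInc_eq hK hu hv (g := fun z => g z + g' z) (hg.add hg')
    fun z hz => by
      rw [Complex.exp_add, hgf z hz, hgf' z hz]
      exact div_mul_cancel₀ _ (h0 z hz)]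
  ring

namespace PlaneDrawing

variable {V : Type*} {G : SimpleGraph V} (D : PlaneDrawing G)

theorem point_edgeSrc_mem (e : G.edgeSet) : D.point (edgeSrc e) ∈ D.arc e :=
  (D.isArc_edge e).left_mem

theorem point_edgeTgt_mem (e : G.edgeSet) : D.point (edgeTgt e) ∈ D.arc e :=
  (D.isArc_edge e).right_mem

/-- The increment of `log (z - p)` along an edge. -/
noncomputable def edgeInc (p : Plane) (e : G.edgeSet) : ℂ :=
  logInc (diffC p) (D.arc e) (D.point (edgeSrc e)) (D.point (edgeTgt e))

theorem edgeInc_sub_edgeInc {e : G.edgeSet} {p q : Plane} (hq : q ∉ D.arc e) {g : Plane → ℂ}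
    (hg : ContinuousOn g (D.arc e))
    (hgf : ∀ z ∈ D.arc e, Complex.exp (g z) = diffC p z / diffC q z) :
    D.edgeInc p e - D.edgeInc q e = g (D.point (edgeTgt e)) - g (D.point (edgeSrc e)) :=
  logInc_sub_eq (D.isArc_edge e).isPreconnected (D.point_edgeSrc_mem e) (D.point_edgeTgt_mem e) hg
    hgf (fun _ hz => diffC_ne_zero_of_notMem hq hz) ((D.isArc_edge e).isLogTrivial.hasLog_diffC hq)

/-- The interior of an edge: its points that are not ends. -/
def edgeInterior (e : G.edgeSet) : Set Plane :=
  D.arc e \ {D.point (edgeSrc e), D.point (edgeTgt e)}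

theorem edgeInterior_nonempty (e : G.edgeSet) : (D.edgeInterior e).Nonempty := by
  by_contra h
  rw [Set.not_nonempty_iff_eq_empty] at h
  have := (D.isArc_edge e).subset_closure_diff (D.point_edgeSrc_mem e)
  rw [edgeInterior] at h
  rw [h, closure_empty] at this
  exact this

/-- All edges of the graph apart from `e`. -/
def otherEdges (e : G.edgeSet) : Set (Sym2 V) := G.edgeSet \ {(e : Sym2 V)}

theorem disjoint_edgeInterior (e : G.edgeSet) :
    Disjoint (D.edgeInterior e) (D.edgesCarrier (otherEdges e)) := by
  rw [Set.disjoint_left]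
  rintro z ⟨hz, hne⟩ hz'
  obtain ⟨e', he', hz'⟩ := mem_edgesCarrier.1 hz'
  obtain ⟨x, hx, -, rfl⟩ := D.exists_mem_of_mem_arc e.2 he'.1 (fun h => he'.2 h.symm) hz hz'
  rw [← mk_edgeSrc_edgeTgt e] at hx
  rcases Sym2.mem_iff.1 hx with rfl | rfl <;> simp at hne

/-- The component of the complement of the other edges that contains the interior of `e`. -/
noncomputable def edgeRegion (e : G.edgeSet) : Set Plane :=
  connectedComponentIn (D.edgesCarrier (otherEdges e))ᶜ (D.edgeInterior_nonempty e).some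

theorem edgeInterior_subset_edgeRegion (e : G.edgeSet) : D.edgeInterior e ⊆ D.edgeRegion e :=
  (D.isArc_edge e).isPreconnected_diff.subset_connectedComponentIn
    (D.edgeInterior_nonempty e).some_mem
    (Set.subset_compl_iff_disjoint_right.2 (D.disjoint_edgeInterior e))

theorem disjoint_edgeRegion (e : G.edgeSet) :
    Disjoint (D.edgeRegion e) (D.edgesCarrier (otherEdges e)) :=
  Set.subset_compl_iff_disjoint_right.1 (connectedComponentIn_subset _ _)

theorem mem_edgesCarrier_iff_of_edge (e : G.edgeSet) {z : Plane} :
    z ∈ D.edgesCarrier G.edgeSet ↔ z ∈ D.edgesCarrier (otherEdges e) ∨ z ∈ D.arc e := by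
  simp only [mem_edgesCarrier]
  constructor
  · rintro ⟨e', he', hz⟩
    by_cases h : e' = e
    · exact Or.inr (h ▸ hz)
    · exact Or.inl ⟨e', ⟨he', h⟩, hz⟩
  · rintro (⟨e', he', hz⟩ | hz)
    exacts [⟨e', he'.1, hz⟩, ⟨e, e.2, hz⟩]

theorem walkCarrier_subset {u v : V} (p : G.Walk u v) (huv : u ≠ v) :
    D.walkCarrier p ⊆ D.edgesCarrier G.edgeSet := by
  intro z hz
  rcases (D.mem_walkCarrier p).1 hz with rfl | ⟨e, he, hz⟩
  · have hnil : ¬ p.Nil := fun h => huv h.eq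
    exact mem_edgesCarrier.2 ⟨s(p.penultimate, v), p.adj_penultimate hnil,
      (D.isArc_of_adj (p.adj_penultimate hnil)).right_mem⟩
  · exact mem_edgesCarrier.2 ⟨e, p.edges_subset_edgeSet he, hz⟩

theorem notMem_cycle_of_notMem {e : G.edgeSet} (p : G.Walk (edgeSrc e) (edgeTgt e)) {q : Plane}
    (hq : q ∉ D.edgesCarrier G.edgeSet) : q ∉ D.arc e ∪ D.walkCarrier p := by
  rintro (h | h)
  · exact hq (D.arc_subset_edgesCarrier e.2 h)
  · exact hq (D.walkCarrier_subset p (adj_edgeSrc_edgeTgt e).ne h)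

section Euler

variable [Fintype G.edgeSet]

/-- The sum of the windings of the cycles of a chain around the point `p`. -/
noncomputable def cycleWinding (p : Plane) : Module.Dual ℂ (cycleSpace G) :=
  (∑ e, D.edgeInc p e • LinearMap.proj (R := ℂ) (φ := fun _ : G.edgeSet => ℂ) e).comp
    (cycleSpace G).subtype

theorem cycleWinding_apply (p : Plane) (φ : cycleSpace G) :
    D.cycleWinding p φ = ∑ e, (φ : G.edgeSet → ℂ) e * D.edgeInc p e := by
  simp [cycleWinding, mul_comm]

theorem sum_mul_sub_eq_zero (φ : cycleSpace G) (g : Plane → ℂ) :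
    ∑ e, (φ : G.edgeSet → ℂ) e * (g (D.point (edgeTgt e)) - g (D.point (edgeSrc e))) = 0 :=
  mem_cycleSpace.1 φ.2 fun v => g (D.point v)

theorem isCompact_edgesCarrier_edgeSet : IsCompact (D.edgesCarrier G.edgeSet) :=
  D.isCompact_edgesCarrier (Set.toFinite _) subset_rfl

theorem isCompact_edgesCarrier_otherEdges (e : G.edgeSet) :
    IsCompact (D.edgesCarrier (otherEdges e)) :=
  D.isCompact_edgesCarrier ((Set.toFinite G.edgeSet).subset Set.sdiff_subset) Set.sdiff_subset

theorem isOpen_edgeRegion (e : G.edgeSet) : IsOpen (D.edgeRegion e) :=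
  (D.isCompact_edgesCarrier_otherEdges e).isClosed.isOpen_compl.connectedComponentIn

theorem cycleWinding_eq_zero {p : Plane} (hp : p ∈ outer (D.edgesCarrier G.edgeSet)) :
    D.cycleWinding p = 0 := by
  obtain ⟨g, hg, hgf⟩ := hasLog_diffC_of_mem_outer D.isCompact_edgesCarrier_edgeSet hp
  ext φ
  rw [cycleWinding_apply, LinearMap.zero_apply, ← D.sum_mul_sub_eq_zero φ g]
  refine Finset.sum_congr rfl fun e _ => ?_
  have hsub := D.arc_subset_edgesCarrier e.2
  rw [edgeInc, logInc_eq (D.isArc_edge e).isPreconnected (D.point_edgeSrc_mem e)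
    (D.point_edgeTgt_mem e) (hg.mono hsub) fun z hz => hgf z (hsub hz)]

/-- Crossing the edge `e` changes the winding of a cycle by its coefficient at `e` times a factor
that is the same for all cycles. -/
theorem exists_cycleWinding_sub_eq {e : G.edgeSet} {p q : Plane} (hp : p ∈ D.edgeRegion e)
    (hq : q ∈ D.edgeRegion e) :
    ∃ J : ℂ, ∀ φ : cycleSpace G,
      D.cycleWinding p φ - D.cycleWinding q φ = (φ : G.edgeSet → ℂ) e * J := by
  obtain ⟨g, hg, hgf⟩ := hasLog_div_of_isPreconnected
    (D.isCompact_edgesCarrier_otherEdges e).isClosed isPreconnected_connectedComponentIn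
    (D.disjoint_edgeRegion e) hp hq
  -- away from `e`, the increments change by those of `g`, which sum to zero along cycles
  refine ⟨D.edgeInc p e - D.edgeInc q e -
    (g (D.point (edgeTgt e)) - g (D.point (edgeSrc e))), fun φ => ?_⟩
  rw [cycleWinding_apply, cycleWinding_apply, ← Finset.sum_sub_distrib,
    ← sub_zero (Finset.sum _ _), ← D.sum_mul_sub_eq_zero φ g, ← Finset.sum_sub_distrib,
    Finset.sum_eq_single e]
  · ring
  · intro e' _ hne
    have hsub : D.arc e' ⊆ D.edgesCarrier (otherEdges e) :=
      D.arc_subset_edgesCarrier ⟨e'.2, fun h => hne (Subtype.ext h)⟩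
    rw [← mul_sub, D.edgeInc_sub_edgeInc (fun hq' => Set.disjoint_left.1
      (D.disjoint_edgeRegion e) hq (hsub hq')) (hg.mono hsub) fun z hz => hgf z (hsub hz)]
    ring
  · simp

/-- The cycle of an edge and a path that joins its ends, as an element of the cycle space. -/
theorem exists_cycle_chain {e : G.edgeSet} {p : G.Walk (edgeSrc e) (edgeTgt e)} (hp : p.IsPath)
    (hep : (e : Sym2 V) ∉ p.edges) :
    ∃ (h : IsJordanPair (D.point (edgeSrc e)) (D.point (edgeTgt e)) (D.arc e) (D.walkCarrier p))
      (φ : cycleSpace G), (φ : G.edgeSet → ℂ) e = 1 ∧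
      ∀ q ∉ D.arc e ∪ D.walkCarrier p, D.cycleWinding q φ = h.winding q := by
  classical
  have hJ : IsJordanPair (D.point (edgeSrc e)) (D.point (edgeTgt e)) (D.arc e)
      (D.walkCarrier p) := by
    have := D.isJordanPair (adj_edgeSrc_edgeTgt e) p hp (by rwa [mk_edgeSrc_edgeTgt])
    rwa [mk_edgeSrc_edgeTgt] at this
  refine ⟨hJ, ⟨Pi.single e 1 - walkChain p, mem_cycleSpace.2 fun A => ?_⟩, ?_, fun q hq => ?_⟩
  · simp only [Pi.sub_apply, sub_mul, Finset.sum_sub_distrib, sum_walkChain_sub]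
    simp [Pi.single_apply, ite_mul]
  · simp [walkChain_eq_zero p hep]
  · rw [Set.mem_union, not_or] at hq
    rw [cycleWinding_apply, IsJordanPair.winding, D.logInc_walkCarrier p hp
      ((D.isLogTrivial_walkCarrier p hp).1.hasLog_diffC hq.2), ← sum_walkChain_logInc D]
    simp only [Pi.sub_apply, sub_mul, Finset.sum_sub_distrib, edgeInc]
    simp [Pi.single_apply, ite_mul]

/-- Around every nonzero element of the cycle space there is a point with nonzero winding. -/
theorem exists_cycleWinding_ne_zero {φ : cycleSpace G} (hφ : φ ≠ 0) :
    ∃ p ∉ D.edgesCarrier G.edgeSet, D.cycleWinding p φ ≠ 0 := by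
  obtain ⟨e, he⟩ : ∃ e, (φ : G.edgeSet → ℂ) e ≠ 0 := by
    by_contra! hcon
    exact hφ (Subtype.ext (funext hcon))
  obtain ⟨w, hw, hew⟩ := exists_isPath_of_not_isBridge fun hb => he (eq_zero_of_isBridge φ.2 hb)
  obtain ⟨hJ, ψ, hψe, hψ⟩ := D.exists_cycle_chain hw hew
  obtain ⟨x, hx⟩ := D.edgeInterior_nonempty e
  have hxR := D.edgeInterior_subset_edgeRegion e hx
  -- points close to the edge, inside and outside a cycle through it
  obtain ⟨p, hpR, hp⟩ := mem_closure_iff.1 (hJ.arc_subset_closure_inner hx.1) _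
    (D.isOpen_edgeRegion e) hxR
  obtain ⟨q, hqR, hq⟩ := mem_closure_iff.1 (hJ.arc_subset_closure_outer hx.1) _
    (D.isOpen_edgeRegion e) hxR
  have hoff : ∀ y ∈ D.edgeRegion e, y ∉ D.arc e ∪ D.walkCarrier w →
      y ∉ D.edgesCarrier G.edgeSet := fun y hy hyJ hyX => by
    rcases (D.mem_edgesCarrier_iff_of_edge e).1 hyX with h | h
    · exact Set.disjoint_left.1 (D.disjoint_edgeRegion e) hy h
    · exact hyJ (Or.inl h)
  obtain ⟨J, hJump⟩ := D.exists_cycleWinding_sub_eq hpR hqR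
  have hJ0 : J ≠ 0 := by
    have h1 := hJump ψ
    rw [hψ p hp.1, hψ q hq.1, hψe, hJ.winding_eq_zero hq, one_mul, sub_zero] at h1
    rw [← h1]
    exact hJ.winding_ne_zero hp
  by_contra! hcon
  have h1 := hJump φ
  rw [hcon p (hoff p hpR hp.1), hcon q (hoff q hqR hq.1), sub_self] at h1
  exact mul_ne_zero he hJ0 h1.symm

/-- The face of the plane graph that contains `p`. -/
def face (p : Plane) : Set Plane := connectedComponentIn (D.edgesCarrier G.edgeSet)ᶜ p

theorem isOpen_face (p : Plane) : IsOpen (D.face p) :=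
  D.isCompact_edgesCarrier_edgeSet.isClosed.isOpen_compl.connectedComponentIn

/-- The edges that are not bridges and have an inner point on the boundary of the face of `p`. -/
def boundaryEdges (p : Plane) : Set G.edgeSet :=
  {e | ¬ G.IsBridge e ∧ (D.edgeInterior e ∩ closure (D.face p)).Nonempty}

theorem mem_edgeRegion_of_mem_boundaryEdges {p : Plane} (hp : p ∉ D.edgesCarrier G.edgeSet)
    {e : G.edgeSet} (he : e ∈ D.boundaryEdges p) : p ∈ D.edgeRegion e := by
  obtain ⟨-, x, hx, hxc⟩ := he
  obtain ⟨y, hyR, hyF⟩ := mem_closure_iff.1 hxc _ (D.isOpen_edgeRegion e)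
    (D.edgeInterior_subset_edgeRegion e hx)
  rw [edgeRegion, connectedComponentIn_eq hyR]
  refine IsPreconnected.subset_connectedComponentIn (s := D.face p)
    isPreconnected_connectedComponentIn hyF ?_ (mem_connectedComponentIn hp)
  refine (connectedComponentIn_subset _ _).trans (Set.compl_subset_compl.2 fun z hz => ?_)
  exact (D.mem_edgesCarrier_iff_of_edge e).2 (Or.inl hz)

/-- All cycles have the same windings around the faces that meet the interior of an edge on the same
side of a cycle through this edge. Hence at most two such faces count. -/
theorem cycleWinding_eq_of_mem_boundaryEdges {e : G.edgeSet} {w : G.Walk (edgeSrc e) (edgeTgt e)}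
    (hw : w.IsPath) (hew : (e : Sym2 V) ∉ w.edges) {p q : Plane}
    (hp : p ∉ D.edgesCarrier G.edgeSet) (hq : q ∉ D.edgesCarrier G.edgeSet)
    (hpe : e ∈ D.boundaryEdges p) (hqe : e ∈ D.boundaryEdges q)
    (hpq : p ∈ inner (D.arc e ∪ D.walkCarrier w) ↔ q ∈ inner (D.arc e ∪ D.walkCarrier w)) :
    D.cycleWinding p = D.cycleWinding q := by
  obtain ⟨hJ, ψ, hψe, hψ⟩ := D.exists_cycle_chain hw hew
  obtain ⟨J, hJump⟩ := D.exists_cycleWinding_sub_eq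
    (D.mem_edgeRegion_of_mem_boundaryEdges hp hpe) (D.mem_edgeRegion_of_mem_boundaryEdges hq hqe)
  have hpJ := D.notMem_cycle_of_notMem w hp
  have hqJ := D.notMem_cycle_of_notMem w hq
  have hwind : hJ.winding p = hJ.winding q := by
    by_cases h : p ∈ inner (D.arc e ∪ D.walkCarrier w)
    · obtain ⟨-, N, -, hN⟩ := hJ.exists_winding_eq
      rw [hN p h, hN q (hpq.1 h)]
    · rw [hJ.winding_eq_zero ((mem_inner_or_mem_outer hpJ).resolve_left h),
        hJ.winding_eq_zero ((mem_inner_or_mem_outer hqJ).resolve_left fun h' => h (hpq.2 h'))]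
  have hJ0 : J = 0 := by
    have h1 := hJump ψ
    rw [hψ p hpJ, hψ q hqJ, hψe, hwind, sub_self, one_mul] at h1
    exact h1.symm
  ext φ
  have h1 := hJump φ
  rwa [hJ0, mul_zero, sub_eq_zero] at h1

/-- A bounded face of a triangle-free plane graph has at least four edges on its boundary: without
a cycle, its boundary would not separate the plane. -/
theorem four_le_ncard_boundaryEdges [Finite V] (hG : G.CliqueFree 3) {p : Plane}
    (hp : p ∈ inner (D.edgesCarrier G.edgeSet)) : 4 ≤ (D.boundaryEdges p).ncard := by
  classical
  let S : Set (Sym2 V) := {e | ∃ h : e ∈ G.edgeSet, G.IsBridge e ∨ ⟨e, h⟩ ∈ D.boundaryEdges p}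
  have hSG : S ⊆ G.edgeSet := fun e he => he.1
  have hcyc : ¬ (SimpleGraph.fromEdgeSet S).IsAcyclic := by
    intro hac
    -- a drawing of a forest, with finitely many points, that contains the frontier of the face
    have hlog : IsLogTrivial (D.edgesCarrier S ∪
        (Set.range D.point ∩ D.edgesCarrier G.edgeSet)) :=
      (D.isLogTrivial_edgesCarrier_of_isAcyclic ((Set.toFinite G.edgeSet).subset hSG) hSG
        hac).union_finite ((Set.finite_range D.point).subset Set.inter_subset_left)
    have hsub := compl_subset_of_frontier_subset hlog.1 (fun q hq => hlog.hasLog_diffC hq)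
      (D.isOpen_face p) (by
        intro z hz
        by_cases hzX : z ∈ D.edgesCarrier G.edgeSet
        · right
          by_cases hzV : z ∈ Set.range D.point
          · exact Or.inr ⟨hzV, hzX⟩
          · obtain ⟨e, he, hze⟩ := mem_edgesCarrier.1 hzX
            refine Or.inl (mem_edgesCarrier.2 ⟨e, ⟨he, ?_⟩, hze⟩)
            by_cases hb : G.IsBridge e
            · exact Or.inl hb
            · refine Or.inr ⟨hb, z, ⟨hze, ?_⟩, hz⟩
              rintro (h | h)
              · exact hzV ⟨_, h.symm⟩
              · exact hzV ⟨_, (Set.mem_singleton_iff.1 h).symm⟩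
        · left
          have hVo : IsOpen (D.face z) := D.isOpen_face z
          obtain ⟨y, hy, hyU⟩ := mem_closure_iff.1 hz _ hVo (mem_connectedComponentIn hzX)
          rw [face, connectedComponentIn_eq hyU, ← connectedComponentIn_eq hy]
          exact mem_connectedComponentIn hzX)
      ⟨p, mem_connectedComponentIn hp.1, by
        rintro (h | h)
        · obtain ⟨e, he, hpe⟩ := mem_edgesCarrier.1 h
          exact hp.1 (D.arc_subset_edgesCarrier (hSG he) hpe)
        · exact hp.1 h.2⟩
    exact not_isBounded_outer hlog.1 (hp.2.subset (fun z hz => hsub hz.1))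
  rw [SimpleGraph.IsAcyclic] at hcyc
  push Not at hcyc
  obtain ⟨v, c, hc⟩ := hcyc
  have hle : SimpleGraph.fromEdgeSet S ≤ G := by
    rw [SimpleGraph.fromEdgeSet_le]
    exact Set.sdiff_subset.trans hSG
  have hcG : (c.mapLe hle).IsCycle := hc.mapLe hle
  have hlen3 := hc.three_le_length
  have hlen : 4 ≤ c.edges.length := by
    rw [SimpleGraph.Walk.length_edges]
    by_contra hlt
    obtain ⟨s, hs⟩ := SimpleGraph.is3Clique_iff_exists_cycle_length_three.2
      ⟨v, c.mapLe hle, hcG, by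
        rw [SimpleGraph.Walk.mapLe, SimpleGraph.Walk.length_map]
        omega⟩
    exact hG s hs
  have hsub : (c.edges.toFinset : Set (Sym2 V)) ⊆ Subtype.val '' D.boundaryEdges p := by
    intro e he
    rw [List.coe_toFinset] at he
    have heS := c.edges_subset_edgeSet he
    rw [SimpleGraph.edgeSet_fromEdgeSet] at heS
    obtain ⟨heG, hb⟩ := heS.1
    refine ⟨⟨e, heG⟩, hb.resolve_left fun hb => ?_, rfl⟩
    refine (SimpleGraph.isBridge_iff_forall_cycle_notMem heG).1 hb _ hcG ?_
    rwa [SimpleGraph.Walk.edges_mapLe_eq_edges]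
  have h1 := Set.ncard_le_ncard hsub (Set.toFinite _)
  rw [Set.ncard_coe_finset, List.toFinset_card_of_nodup hc.edges_nodup,
    Set.ncard_image_of_injective _ Subtype.val_injective] at h1
  omega

/-- A triangle-free plane graph on `n` vertices has at most `2n` edges. -/
theorem card_edgeSet_le [Fintype V] (D : PlaneDrawing G) (hG : G.CliqueFree 3) :
    Fintype.card G.edgeSet ≤ 2 * Fintype.card V := by
  classical
  let W : Set (Module.Dual ℂ (cycleSpace G)) :=
    D.cycleWinding '' (D.edgesCarrier G.edgeSet)ᶜ
  have hco : (Submodule.span ℂ W).dualCoannihilator = ⊥ := by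
    rw [Submodule.eq_bot_iff]
    intro φ hφ
    by_contra hne
    obtain ⟨p, hp, hpφ⟩ := D.exists_cycleWinding_ne_zero hne
    exact hpφ ((Submodule.mem_dualCoannihilator φ).1 hφ _ (Submodule.subset_span ⟨p, hp, rfl⟩))
  have hspan := Subspace.finrank_add_finrank_dualCoannihilator_eq (Submodule.span ℂ W)
  rw [hco, finrank_bot, add_zero] at hspan
  obtain ⟨b, hbW, hbspan, hbind⟩ := exists_linearIndependent ℂ W
  have hbfin : b.Finite := hbind.setFinite
  let _ : Fintype b := hbfin.fintype
  have hbcard := finrank_span_set_eq_card (s := b) hbind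
  rw [hbspan, hspan] at hbcard
  have hpt : ∀ f : Module.Dual ℂ (cycleSpace G), ∃ p : Plane,
      f ∈ b → p ∉ D.edgesCarrier G.edgeSet ∧ D.cycleWinding p = f := fun f => by
    by_cases hf : f ∈ b
    · obtain ⟨p, hp, hpf⟩ := hbW hf
      exact ⟨p, fun _ => ⟨hp, hpf⟩⟩
    · exact ⟨0, fun h => absurd h hf⟩
  -- one point in a bounded face for each member of a basis of windings
  choose P hP' using hpt
  have hPX := fun f hf => (hP' f hf).1
  have hP := fun f hf => (hP' f hf).2
  have hinner : ∀ f ∈ b, P f ∈ inner (D.edgesCarrier G.edgeSet) := fun f hf => by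
    refine (mem_inner_or_mem_outer (hPX _ hf)).resolve_right fun ho => ?_
    refine hbind.ne_zero ⟨f, hf⟩ ?_
    exact (hP f hf).symm.trans (D.cycleWinding_eq_zero ho)
  -- double counting of the pairs of a face and an edge on its boundary
  have hcount := Finset.card_mul_le_card_mul (s := b.toFinset)
    (t := (Finset.univ : Finset G.edgeSet))
    (fun f e => e ∈ D.boundaryEdges (P f)) (m := 4) (n := 2)
    (fun f hf => by
      have h1 := D.four_le_ncard_boundaryEdges hG (hinner f (by simpa using hf))
      rw [Set.ncard_eq_toFinset_card'] at h1
      convert h1 using 2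
      ext e
      simp [Finset.bipartiteAbove])
    (fun e _ => by
      by_contra hlt
      rw [not_le, Finset.two_lt_card] at hlt
      simp only [Finset.bipartiteBelow, Finset.mem_filter, Set.mem_toFinset] at hlt
      obtain ⟨f₁, ⟨h₁, h₁'⟩, f₂, ⟨h₂, h₂'⟩, f₃, ⟨h₃, h₃'⟩, h₁₂, h₁₃, h₂₃⟩ := hlt
      obtain ⟨w, hw, hew⟩ := exists_isPath_of_not_isBridge h₁'.1
      have hkey : ∀ f ∈ b, ∀ f' ∈ b, e ∈ D.boundaryEdges (P f) → e ∈ D.boundaryEdges (P f') →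
          (P f ∈ inner (D.arc e ∪ D.walkCarrier w) ↔ P f' ∈ inner (D.arc e ∪ D.walkCarrier w)) →
          f = f' := fun f hf f' hf' he he' hiff => by
        rw [← hP _ hf, ← hP _ hf']
        exact D.cycleWinding_eq_of_mem_boundaryEdges hw hew (hPX _ hf) (hPX _ hf') he he' hiff
      have k₁₂ := mt (hkey f₁ h₁ f₂ h₂ h₁' h₂') h₁₂
      have k₁₃ := mt (hkey f₁ h₁ f₃ h₃ h₁' h₃') h₁₃
      have k₂₃ := mt (hkey f₂ h₂ f₃ h₃ h₂' h₃') h₂₃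
      tauto)
  rw [Finset.card_univ, ← hbcard] at hcount
  have := card_edgeSet_le_finrank_cycleSpace (G := G)
  omega

end Euler

end PlaneDrawing

/-! ### Laminar families of sets -/

/-- Two sets do not cross: they are disjoint or nested. -/
def Laminar {α : Type*} (S T : Set α) : Prop := S ∩ T = ∅ ∨ S ⊆ T ∨ T ⊆ S

theorem Laminar.symm {α : Type*} {S T : Set α} (h : Laminar S T) : Laminar T S := by
  rcases h with h | h | h
  · exact Or.inl (by rwa [Set.inter_comm])
  · exact Or.inr (Or.inr h)
  · exact Or.inr (Or.inl h)

/-- If `D` and `D'` have the same symmetric difference as the crossing sets `C` and `C'`, and do not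
cross them, then `D` is the intersection, the union or a difference of `C` and `C'`. -/
theorem eq_of_laminar_of_xor {α : Type*} {C C' D D' : Set α} (h : ¬ Laminar C C')
    (hDC' : Laminar D C') (hD'C : Laminar D' C) (hD'C' : Laminar D' C')
    (hxor : ∀ p, (p ∈ D ↔ p ∈ D') ↔ (p ∈ C ↔ p ∈ C')) :
    D = C ∩ C' ∨ D = C ∪ C' ∨ D = C \ C' ∨ D = C' \ C := by
  simp only [Laminar, not_or, Set.not_subset, ← Set.not_nonempty_iff_eq_empty, not_not] at h
  obtain ⟨⟨p, hp, hp'⟩, ⟨q, hq, hq'⟩, ⟨r, hr, hr'⟩⟩ := h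
  simp only [Laminar, Set.eq_empty_iff_forall_notMem, Set.subset_def, Set.mem_inter_iff] at *
  have hp0 := hxor p
  have hq0 := hxor q
  have hr0 := hxor r
  by_cases hpD : p ∈ D <;> by_cases hqD : q ∈ D <;> by_cases hrD : r ∈ D
  · right; left
    ext y
    have := hxor y
    grind
  · exfalso; grind
  · exfalso; grind
  · left
    ext y
    have := hxor y
    grind
  · exfalso; grind
  · right; right; left
    ext y
    have := hxor y
    grind
  · right; right; right
    ext y
    have := hxor y
    grind
  · exfalso; grind

/-- A set that crosses neither of two crossing sets does not cross their boolean combinations. -/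
theorem Laminar.of_eq {α : Type*} {C C' D X : Set α} (h : ¬ Laminar C C')
    (hD : D = C ∩ C' ∨ D = C ∪ C' ∨ D = C \ C' ∨ D = C' \ C)
    (hC : Laminar X C) (hC' : Laminar X C') : Laminar X D := by
  simp only [Laminar, not_or, Set.not_subset, ← Set.not_nonempty_iff_eq_empty, not_not] at h
  obtain ⟨⟨p, hp, hp'⟩, ⟨q, hq, hq'⟩, ⟨r, hr, hr'⟩⟩ := h
  rcases hD with rfl | rfl | rfl | rfl <;>
  simp only [Laminar, Set.eq_empty_iff_forall_notMem, Set.subset_def, Set.mem_inter_iff,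
    Set.mem_union, Set.mem_sdiff] at * <;>
  rcases hC with h1 | h1 | h1 <;> rcases hC' with h2 | h2 | h2 <;> grind

/-! ### Jordan curves that do not cross -/

/-- The consequences of the Jordan curve theorem for a closed curve that are used below. -/
structure IsJordanCurve (K : Set Plane) : Prop where
  isCompact : IsCompact K
  isPreconnected_inner : IsPreconnected (inner K)
  subset_closure_outer : K ⊆ closure (outer K)

namespace IsJordanCurve

variable {K L : Set Plane}

theorem dense_compl (hK : IsJordanCurve K) : Dense Kᶜ := by
  intro z
  by_cases hz : z ∈ K
  · exact closure_mono (fun p hp => hp.1) (hK.subset_closure_outer hz)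
  · exact subset_closure hz

theorem inner_subset_of_outer_subset (hK : IsJordanCurve K) (hL : IsClosed L)
    (h : outer K ⊆ outer L) : inner L ⊆ inner K := by
  intro p hp
  by_cases hpK : p ∈ K
  · obtain ⟨y, hy, hy'⟩ := mem_closure_iff.1 (hK.subset_closure_outer hpK) _ (isOpen_inner hL) hp
    exact absurd (h hy') (Set.disjoint_left.1 (disjoint_inner_outer L) hy)
  · refine (mem_inner_or_mem_outer hpK).resolve_right fun ho => ?_
    exact Set.disjoint_left.1 (disjoint_inner_outer L) hp (h ho)

/-- If the part of `L` off `K` is connected, then `L` does not cross `K`. -/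
theorem laminar_inner (hK : IsJordanCurve K) (hL : IsJordanCurve L)
    (h : IsPreconnected (L \ K)) : Laminar (inner K) (inner L) := by
  rcases subset_inner_or_subset_outer h Set.disjoint_sdiff_left with h1 | h1
  · refine Or.inr (Or.inr (hK.inner_subset_of_outer_subset hL.isCompact.isClosed ?_))
    refine subset_outer_of_not_isBounded (isPreconnected_outer hK.isCompact) ?_
      (not_isBounded_outer hK.isCompact)
    rw [Set.disjoint_left]
    intro z hz hzL
    exact Set.disjoint_left.1 (disjoint_inner_outer K) (h1 ⟨hzL, hz.1⟩) hz
  · have hdisj : Disjoint (inner K) L := by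
      rw [Set.disjoint_left]
      intro z hz hzL
      exact Set.disjoint_left.1 (disjoint_inner_outer K) hz (h1 ⟨hzL, hz.1⟩)
    rcases subset_inner_or_subset_outer hK.isPreconnected_inner hdisj with h2 | h2
    · exact Or.inr (Or.inl h2)
    · left
      rw [← Set.disjoint_iff_inter_eq_empty, Set.disjoint_left]
      exact fun z hz hz' => Set.disjoint_left.1 (disjoint_inner_outer L) hz' (h2 hz)

theorem inner_subset_iff (hK : IsJordanCurve K) (hL : IsJordanCurve L) {U : Set Plane}
    (hU : Dense U) :
    inner K ∩ U ⊆ inner L ∩ U ↔ inner K ⊆ inner L := by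
  refine ⟨fun h p hp => ?_, fun h => Set.inter_subset_inter_left _ h⟩
  by_contra hpL
  have hcl : p ∈ closure (outer L) := by
    by_cases h1 : p ∈ L
    · exact hL.subset_closure_outer h1
    · exact subset_closure ((mem_inner_or_mem_outer h1).resolve_left hpL)
  obtain ⟨y, hy, hy'⟩ := mem_closure_iff.1 hcl _ (isOpen_inner hK.isCompact.isClosed) hp
  obtain ⟨w, ⟨hw, hw'⟩, hwU⟩ := hU.inter_open_nonempty _
    ((isOpen_inner hK.isCompact.isClosed).inter (isOpen_outer hL.isCompact.isClosed)) ⟨y, hy, hy'⟩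
  exact Set.disjoint_left.1 (disjoint_inner_outer L) (h ⟨hw, hwU⟩).1 hw'

/-- Crossing can be tested on a dense set of points. -/
theorem laminar_inter_iff (hK : IsJordanCurve K) (hL : IsJordanCurve L) {U : Set Plane}
    (hU : Dense U) :
    Laminar (inner K ∩ U) (inner L ∩ U) ↔ Laminar (inner K) (inner L) := by
  rw [Laminar, Laminar, hK.inner_subset_iff hL hU, hL.inner_subset_iff hK hU,
    ← Set.inter_inter_distrib_right]
  refine or_congr ⟨fun h => ?_, fun h => by simp [h]⟩ Iff.rfl
  by_contra hne
  obtain ⟨w, hw, hwU⟩ := hU.inter_open_nonempty _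
    ((isOpen_inner hK.isCompact.isClosed).inter (isOpen_inner hL.isCompact.isClosed))
    (Set.nonempty_iff_ne_empty.2 hne)
  exact (h ▸ (⟨hw, hwU⟩ : w ∈ inner K ∩ inner L ∩ U) : w ∈ (∅ : Set Plane))

end IsJordanCurve

/-! ### Pentagons -/

/-- The vertices `a, b, c, d, e` form a cycle of length five, in this order. -/
structure IsPentagon {V : Type*} (G : SimpleGraph V) (a b c d e : V) : Prop where
  adj₁ : G.Adj a b
  adj₂ : G.Adj b c
  adj₃ : G.Adj c d
  adj₄ : G.Adj d e
  adj₅ : G.Adj e a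
  ne₁ : a ≠ c
  ne₂ : b ≠ d
  ne₃ : c ≠ e
  ne₄ : d ≠ a
  ne₅ : e ≠ b

section Combinatorics

variable {V : Type*} {G : SimpleGraph V} {a b c d e : V}

theorem IsPentagon.rotate (h : IsPentagon G a b c d e) : IsPentagon G b c d e a :=
  ⟨h.adj₂, h.adj₃, h.adj₄, h.adj₅, h.adj₁, h.ne₂, h.ne₃, h.ne₄, h.ne₅, h.ne₁⟩

theorem IsPentagon.reverse (h : IsPentagon G a b c d e) : IsPentagon G a e d c b :=
  ⟨h.adj₅.symm, h.adj₄.symm, h.adj₃.symm, h.adj₂.symm, h.adj₁.symm, h.ne₄.symm, h.ne₃.symm,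
    h.ne₂.symm, h.ne₁.symm, h.ne₅.symm⟩

theorem not_adj_of_cliqueFree (hG : G.CliqueFree 3) {x y z : V} (h1 : G.Adj x y)
    (h2 : G.Adj y z) : ¬ G.Adj x z := by
  classical
  exact fun h3 => hG {x, y, z} (SimpleGraph.is3Clique_triple_iff.2 ⟨h1, h3, h2⟩)

/-- The path `a, e, d, c, b` in a pentagon, which together with the edge `ab` forms the cycle. -/
def IsPentagon.walk (h : IsPentagon G a b c d e) : G.Walk a b :=
  .cons h.adj₅.symm (.cons h.adj₄.symm (.cons h.adj₃.symm (.cons h.adj₂.symm .nil)))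

theorem IsPentagon.isPath_walk (h : IsPentagon G a b c d e) : h.walk.IsPath := by
  rw [SimpleGraph.Walk.isPath_def]
  have := h.adj₁.ne
  have := h.adj₂.ne'
  have := h.adj₃.ne'
  have := h.adj₄.ne'
  have := h.adj₅.ne'
  have := h.ne₁
  have := h.ne₂.symm
  have := h.ne₃.symm
  have := h.ne₄.symm
  have := h.ne₅
  simp [IsPentagon.walk, *]

theorem IsPentagon.notMem_edges_walk (h : IsPentagon G a b c d e) : s(a, b) ∉ h.walk.edges := by
  have := h.adj₁.ne
  have := h.adj₅.ne'
  have := h.ne₁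
  have := h.ne₄.symm
  have := h.ne₅.symm
  simp [IsPentagon.walk, *]

end Combinatorics

namespace PlaneDrawing

variable {V : Type*} {G : SimpleGraph V} (D : PlaneDrawing G)

/-- The points covered by the edges of the pentagon `a, b, c, d, e`. -/
def pentagon (a b c d e : V) : Set Plane :=
  D.arc s(a, b) ∪ (D.arc s(b, c) ∪ (D.arc s(c, d) ∪ (D.arc s(d, e) ∪ D.arc s(e, a))))

theorem pentagon_rotate (a b c d e : V) : D.pentagon b c d e a = D.pentagon a b c d e := by
  ext z
  simp only [pentagon, Set.mem_union]
  tauto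

theorem pentagon_reverse (a b c d e : V) : D.pentagon a e d c b = D.pentagon a b c d e := by
  ext z
  simp only [pentagon, Set.mem_union, Sym2.eq_swap (a := a) (b := e),
    Sym2.eq_swap (a := e) (b := d),
    Sym2.eq_swap (a := d) (b := c), Sym2.eq_swap (a := c) (b := b), Sym2.eq_swap (a := b) (b := a)]
  tauto

theorem arc_union_walkCarrier {a b c d e : V} (h : IsPentagon G a b c d e) :
    D.arc s(a, b) ∪ D.walkCarrier h.walk = D.pentagon a b c d e := by
  rw [← D.pentagon_reverse, ← D.pentagon_rotate]
  have hb := (D.isArc_of_adj h.adj₂).left_mem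
  ext z
  simp only [pentagon, IsPentagon.walk, walkCarrier, Set.mem_union, Set.mem_singleton_iff,
    Sym2.eq_swap (a := b) (b := a), Sym2.eq_swap (a := c) (b := b)]
  constructor
  · rintro (h | h | h | h | h | rfl) <;> tauto
  · tauto

theorem isJordanPair_pentagon {a b c d e : V} (h : IsPentagon G a b c d e) :
    IsJordanPair (D.point a) (D.point b) (D.arc s(a, b)) (D.walkCarrier h.walk) :=
  D.isJordanPair h.adj₁ h.walk h.isPath_walk h.notMem_edges_walk

theorem isJordanCurve_pentagon {a b c d e : V} (h : IsPentagon G a b c d e) :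
    IsJordanCurve (D.pentagon a b c d e) := by
  have key : ∀ {a b c d e : V}, IsPentagon G a b c d e →
      D.arc s(a, b) ⊆ closure (outer (D.pentagon a b c d e)) := fun h => by
    rw [← D.arc_union_walkCarrier h]
    exact (D.isJordanPair_pentagon h).arc_subset_closure_outer
  refine ⟨?_, ?_, ?_⟩
  · rw [← D.arc_union_walkCarrier h]
    exact (D.isJordanPair_pentagon h).isCompact
  · rw [← D.arc_union_walkCarrier h]
    exact (D.isJordanPair_pentagon h).isPreconnected_inner
  · have h1 := key h
    have h2 := key h.rotate
    have h3 := key h.rotate.rotate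
    have h4 := key h.rotate.rotate.rotate
    have h5 := key h.rotate.rotate.rotate.rotate
    simp only [D.pentagon_rotate] at h2 h3 h4 h5
    exact Set.union_subset h1 (Set.union_subset h2 (Set.union_subset h3 (Set.union_subset h4 h5)))

/-- The increment of `log (z - p)` along the edge from `u` to `v`. -/
noncomputable def dartInc (p : Plane) (u v : V) : ℂ :=
  logInc (diffC p) (D.arc s(u, v)) (D.point u) (D.point v)

theorem dartInc_symm (p : Plane) (u v : V) : D.dartInc p u v = -D.dartInc p v u := by
  rw [dartInc, logInc_symm, Sym2.eq_swap, dartInc]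

/-- A point off a pentagon is inside if and only if the winding number is odd. -/
theorem mem_inner_pentagon_iff {a b c d e : V} (h : IsPentagon G a b c d e) {p : Plane}
    (hp : p ∉ D.pentagon a b c d e) : ∃ N : ℤ,
      D.dartInc p a b + D.dartInc p b c + D.dartInc p c d + D.dartInc p d e + D.dartInc p e a =
        N * (2 * Real.pi * Complex.I) ∧ (p ∈ inner (D.pentagon a b c d e) ↔ Odd N) := by
  have hJ := D.isJordanPair_pentagon h
  rw [← D.arc_union_walkCarrier h] at hp ⊢
  have hw := D.winding_isJordanPair h.adj₁ h.walk h.isPath_walk h.notMem_edges_walk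
    (fun h' => hp (Or.inr h'))
  have hsum : D.dartInc p a b + D.dartInc p b c + D.dartInc p c d + D.dartInc p d e +
      D.dartInc p e a = hJ.winding p := by
    rw [hw, D.dartInc_symm p b c, D.dartInc_symm p c d, D.dartInc_symm p d e, D.dartInc_symm p e a]
    simp only [IsPentagon.walk, walkLog, dartInc]
    ring
  rw [hsum]
  rcases mem_inner_or_mem_outer hp with h1 | h1
  · obtain ⟨-, N, hN, hwN⟩ := hJ.exists_winding_eq
    refine ⟨N, hwN p h1, ⟨fun _ => ?_, fun _ => h1⟩⟩
    rcases hN with rfl | rfl <;> decide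
  · refine ⟨0, by simp [hJ.winding_eq_zero h1], ⟨fun h2 => ?_, fun h2 => ?_⟩⟩
    · exact absurd h1 (Set.disjoint_left.1 (disjoint_inner_outer _) h2)
    · exact absurd h2 (by decide)

/-- The subgraph `C` is the pentagon `a, b, c, d, e`. -/
structure IsPentagonOf (C : G.Subgraph) (a b c d e : V) : Prop where
  isPentagon : IsPentagon G a b c d e
  carrier_eq : D.carrier C = D.pentagon a b c d e
  mem_verts_iff : ∀ x, x ∈ C.verts ↔ x = a ∨ x = b ∨ x = c ∨ x = d ∨ x = e

variable {D}

theorem IsPentagonOf.rotate {C : G.Subgraph} {a b c d e : V} (h : D.IsPentagonOf C a b c d e) :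
    D.IsPentagonOf C b c d e a :=
  ⟨h.1.rotate, h.2.trans (D.pentagon_rotate a b c d e).symm, fun x => by rw [h.3 x]; tauto⟩

theorem IsPentagonOf.reverse {C : G.Subgraph} {a b c d e : V} (h : D.IsPentagonOf C a b c d e) :
    D.IsPentagonOf C a e d c b :=
  ⟨h.1.reverse, h.2.trans (D.pentagon_reverse a b c d e).symm, fun x => by rw [h.3 x]; tauto⟩

variable (D)

theorem isPentagonOf_toSubgraph {a b c d e : V} (h : IsPentagon G a b c d e) :
    D.IsPentagonOf (SimpleGraph.Walk.cons h.adj₁.symm h.walk).toSubgraph a b c d e := by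
  have hv : ∀ x, x ∈ (SimpleGraph.Walk.cons h.adj₁.symm h.walk).toSubgraph.verts ↔
      x = a ∨ x = b ∨ x = c ∨ x = d ∨ x = e := fun x => by
    rw [SimpleGraph.Walk.mem_verts_toSubgraph]
    simp only [IsPentagon.walk, SimpleGraph.Walk.support_cons, SimpleGraph.Walk.support_nil,
      List.mem_cons, List.not_mem_nil, or_false]
    tauto
  refine ⟨h, ?_, hv⟩
  have harc : (⋃ e ∈ (SimpleGraph.Walk.cons h.adj₁.symm h.walk).toSubgraph.edgeSet, D.arc e) =
      D.pentagon a b c d e := by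
    rw [← D.arc_union_walkCarrier h]
    ext z
    have hb := (D.isArc_of_adj h.adj₁).right_mem
    simp only [Set.mem_iUnion, SimpleGraph.Walk.mem_edges_toSubgraph, SimpleGraph.Walk.edges_cons,
      List.mem_cons, Set.mem_union, mem_walkCarrier, exists_prop, or_and_right, exists_or,
      exists_eq_left, Sym2.eq_swap (a := b) (b := a)]
    constructor
    · tauto
    · rintro (h | rfl | h) <;> tauto
  rw [carrier, harc, Set.union_eq_right]
  rintro _ ⟨x, hx, rfl⟩
  have h1 := (D.isArc_of_adj h.adj₁).left_mem
  have h2 := (D.isArc_of_adj h.adj₂).left_mem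
  have h3 := (D.isArc_of_adj h.adj₃).left_mem
  have h4 := (D.isArc_of_adj h.adj₄).left_mem
  have h5 := (D.isArc_of_adj h.adj₅).left_mem
  simp only [pentagon, Set.mem_union]
  rcases (hv x).1 hx with rfl | rfl | rfl | rfl | rfl <;> tauto

theorem isFiveCycle_toSubgraph {a b c d e : V} (h : IsPentagon G a b c d e) :
    IsFiveCycle (SimpleGraph.Walk.cons h.adj₁.symm h.walk).toSubgraph := by
  refine ⟨b, _, ?_, rfl, rfl⟩
  rw [SimpleGraph.Walk.cons_isCycle_iff]
  exact ⟨h.isPath_walk, by rw [Sym2.eq_swap]; exact h.notMem_edges_walk⟩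

theorem exists_isPentagonOf {C : G.Subgraph} (hC : IsFiveCycle C) :
    ∃ a b c d e, D.IsPentagonOf C a b c d e := by
  obtain ⟨v, w, hw, hlen, rfl⟩ := hC
  match w, hlen with
  | .cons (v := e) h1 (.cons (v := d) h2 (.cons (v := c) h3 (.cons (v := b) h4
      (.cons h5 .nil)))), _ =>
    have hnd := hw.support_nodup
    simp only [SimpleGraph.Walk.support_cons, SimpleGraph.Walk.support_nil, List.tail_cons,
      List.nodup_cons, List.mem_cons, List.not_mem_nil, or_false, not_or] at hnd
    have hp : IsPentagon G e v b c d :=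
      ⟨h1.symm, h5.symm, h4.symm, h3.symm, h2.symm, by tauto, by tauto, by tauto, by tauto,
        by tauto⟩
    exact ⟨e, v, b, c, d, D.isPentagonOf_toSubgraph hp⟩

end PlaneDrawing

/-! ### Uncrossing pentagons -/

theorem IsPreconnected.union_of_cases {X : Type*} [TopologicalSpace X] {S T : Set X}
    (hS : IsPreconnected S) (hT : IsPreconnected T) (h : S = ∅ ∨ T = ∅ ∨ (S ∩ T).Nonempty) :
    IsPreconnected (S ∪ T) := by
  rcases h with rfl | rfl | ⟨x, hx⟩
  · simpa using hT
  · simpa using hS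
  · exact hS.union x hx.1 hx.2 hT

namespace PlaneDrawing

variable {V : Type*} {G : SimpleGraph V} {D : PlaneDrawing G}

theorem IsPentagonOf.isJordanCurve {C : G.Subgraph} {a b c d e : V}
    (h : D.IsPentagonOf C a b c d e) : IsJordanCurve (D.carrier C) :=
  h.carrier_eq ▸ D.isJordanCurve_pentagon h.isPentagon

theorem point_mem_carrier_iff {C : G.Subgraph} {x : V} :
    D.point x ∈ D.carrier C ↔ x ∈ C.verts := by
  simp only [carrier, Set.mem_union, D.point_injective.mem_set_image, Set.mem_iUnion, exists_prop]
  refine ⟨?_, Or.inl⟩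
  rintro (h | ⟨e, he, hx⟩)
  · exact h
  · exact C.mem_verts_of_mem_edge he (D.mem_of_point_mem_arc e (C.edgeSet_subset he) x hx)

/-- A pentagon in a triangle-free graph has no chords. -/
theorem IsPentagonOf.arc_subset (hG : G.CliqueFree 3) {C : G.Subgraph} {a b c d e : V}
    (h : D.IsPentagonOf C a b c d e) {x y : V} (hx : x ∈ C.verts) (hy : y ∈ C.verts)
    (hxy : G.Adj x y) : D.arc s(x, y) ⊆ D.carrier C := by
  have key : ∀ {a b c d e : V}, D.IsPentagonOf C a b c d e → ∀ y ∈ C.verts, G.Adj a y →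
      D.arc s(a, y) ⊆ D.carrier C := by
    intro a b c d e h y hy hay
    have hP := h.isPentagon
    have h1 : D.arc s(a, b) ⊆ D.carrier C := by
      rw [h.carrier_eq]
      exact Set.subset_union_left
    have h2 : D.arc s(a, e) ⊆ D.carrier C := by
      rw [h.carrier_eq, Sym2.eq_swap]
      exact fun z hz => Or.inr (Or.inr (Or.inr (Or.inr hz)))
    rcases (h.mem_verts_iff y).1 hy with rfl | rfl | rfl | rfl | rfl
    · exact absurd hay (G.irrefl)
    · exact h1
    · exact absurd hay (not_adj_of_cliqueFree hG hP.adj₁ hP.adj₂)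
    · exact absurd hay (not_adj_of_cliqueFree hG hP.adj₅.symm hP.adj₄.symm)
    · exact h2
  rcases (h.mem_verts_iff x).1 hx with rfl | rfl | rfl | rfl | rfl
  · exact key h y hy hxy
  · exact key h.rotate y hy hxy
  · exact key h.rotate.rotate y hy hxy
  · exact key h.rotate.rotate.rotate y hy hxy
  · exact key h.rotate.rotate.rotate.rotate y hy hxy

theorem inter_carrier_subset {C : G.Subgraph} {x y : V} (hxy : G.Adj x y) (hx : x ∉ C.verts) :
    D.arc s(x, y) ∩ D.carrier C ⊆ {D.point y} := by
  rintro z ⟨hz, hzC⟩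
  have hmem : ∀ w ∈ s(x, y), w ∈ C.verts → D.point w = D.point y := by
    intro w hw hwC
    rcases Sym2.mem_iff.1 hw with rfl | rfl
    · exact absurd hwC hx
    · rfl
  rcases hzC with ⟨w, hw, rfl⟩ | hzC
  · exact hmem w (D.mem_of_point_mem_arc _ hxy w hz) hw
  · simp only [Set.mem_iUnion, exists_prop] at hzC
    obtain ⟨e, he, hze⟩ := hzC
    obtain ⟨w, hw, hw', rfl⟩ := D.exists_mem_of_mem_arc hxy (C.edgeSet_subset he)
      (fun h => hx (C.mem_verts_of_mem_edge (h ▸ he) (Sym2.mem_mk_left x y))) hz hze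
    exact hmem w hw (C.mem_verts_of_mem_edge he hw')

theorem isPreconnected_arc_diff_of_notMem {C : G.Subgraph} {x y : V} (hxy : G.Adj x y)
    (hx : x ∉ C.verts) : IsPreconnected (D.arc s(x, y) \ D.carrier C) := by
  have harc := D.isArc_of_adj hxy
  by_cases hy : y ∈ C.verts
  · have : D.arc s(x, y) \ D.carrier C = D.arc s(x, y) \ {D.point y} := by
      ext z
      refine ⟨fun hz => ⟨hz.1, ?_⟩, fun hz => ⟨hz.1, fun h => hz.2 ?_⟩⟩
      · rintro rfl
        exact hz.2 (point_mem_carrier_iff.2 hy)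
      · exact inter_carrier_subset hxy hx ⟨hz.1, h⟩
    rw [this]
    exact harc.symm.isPreconnected_diff_left
  · have : D.arc s(x, y) \ D.carrier C = D.arc s(x, y) := by
      refine sdiff_eq_left.2 (Set.disjoint_left.2 fun z hz hzC => hy ?_)
      rw [← point_mem_carrier_iff (D := D), ← Set.mem_singleton_iff.1
        (inter_carrier_subset hxy hx ⟨hz, hzC⟩)]
      exact hzC
    rw [this]
    exact harc.isPreconnected

/-- The part of an edge off a pentagon is connected, and empty if both ends are on the pentagon. -/
theorem IsPentagonOf.arc_diff (hG : G.CliqueFree 3) {C : G.Subgraph} {a b c d e : V}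
    (h : D.IsPentagonOf C a b c d e) {x y : V} (hxy : G.Adj x y) :
    IsPreconnected (D.arc s(x, y) \ D.carrier C) ∧
      (x ∈ C.verts → y ∈ C.verts → D.arc s(x, y) \ D.carrier C = ∅) := by
  refine ⟨?_, fun hx hy => Set.sdiff_eq_empty.2 (h.arc_subset hG hx hy hxy)⟩
  by_cases hx : x ∈ C.verts
  · by_cases hy : y ∈ C.verts
    · rw [Set.sdiff_eq_empty.2 (h.arc_subset hG hx hy hxy)]
      exact isPreconnected_empty
    · rw [Sym2.eq_swap]
      exact isPreconnected_arc_diff_of_notMem hxy.symm hy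
  · exact isPreconnected_arc_diff_of_notMem hxy hx

/-- If the vertices of the second pentagon that are off the first are consecutive, then the part of
the second pentagon off the first is connected. -/
theorem IsPentagonOf.isPreconnected_diff (hG : G.CliqueFree 3) {C C' : G.Subgraph}
    {a b c d e a' b' c' d' e' : V} (h : D.IsPentagonOf C a b c d e)
    (h' : D.IsPentagonOf C' a' b' c' d' e')
    (hd : d' ∈ C.verts → e' ∈ C.verts) (ha : a' ∈ C.verts → e' ∈ C.verts)
    (hc : c' ∈ C.verts → b' ∈ C.verts ∨ d' ∈ C.verts)
    (hb : b' ∈ C.verts → a' ∈ C.verts ∨ c' ∈ C.verts ∧ d' ∈ C.verts) :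
    IsPreconnected (D.carrier C' \ D.carrier C) := by
  have hP := h'.isPentagon
  rw [h'.carrier_eq, ← D.pentagon_rotate, ← D.pentagon_rotate, ← D.pentagon_rotate,
    ← D.pentagon_rotate, pentagon]
  simp only [Set.union_sdiff_distrib]
  obtain ⟨k₁, z₁⟩ := h.arc_diff hG hP.adj₁
  obtain ⟨k₂, z₂⟩ := h.arc_diff hG hP.adj₂
  obtain ⟨k₃, z₃⟩ := h.arc_diff hG hP.adj₃
  obtain ⟨k₄, z₄⟩ := h.arc_diff hG hP.adj₄
  obtain ⟨k₅, z₅⟩ := h.arc_diff hG hP.adj₅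
  have hshare : ∀ {x y z : V} {T : Set Plane}, G.Adj x y → G.Adj y z → y ∉ C.verts →
      D.arc s(y, z) \ D.carrier C ⊆ T →
      ((D.arc s(x, y) \ D.carrier C) ∩ T).Nonempty := fun {x y z T} hxy hyz hy hT =>
    ⟨D.point y, ⟨(D.isArc_of_adj hxy).right_mem, fun h => hy (point_mem_carrier_iff.1 h)⟩,
      hT ⟨(D.isArc_of_adj hyz).left_mem, fun h => hy (point_mem_carrier_iff.1 h)⟩⟩
  refine k₅.union_of_cases
    (k₁.union_of_cases (k₂.union_of_cases (k₃.union_of_cases k₄ ?_) ?_) ?_) ?_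
  · by_cases hm : d' ∈ C.verts
    · exact Or.inr (Or.inl (z₄ hm (hd hm)))
    · exact Or.inr (Or.inr (hshare hP.adj₃ hP.adj₄ hm subset_rfl))
  · by_cases hm : c' ∈ C.verts
    · rcases hc hm with h1 | h1
      · exact Or.inl (z₂ h1 hm)
      · exact Or.inr (Or.inl (by rw [z₃ hm h1, z₄ h1 (hd h1), Set.union_empty]))
    · exact Or.inr (Or.inr (hshare hP.adj₂ hP.adj₃ hm Set.subset_union_left))
  · by_cases hm : b' ∈ C.verts
    · rcases hb hm with h1 | ⟨h1, h2⟩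
      · exact Or.inl (z₁ h1 hm)
      · exact Or.inr (Or.inl (by
          rw [z₂ hm h1, z₃ h1 h2, z₄ h2 (hd h2), Set.union_empty, Set.union_empty]))
    · exact Or.inr (Or.inr (hshare hP.adj₁ hP.adj₂ hm Set.subset_union_left))
  · by_cases hm : a' ∈ C.verts
    · exact Or.inl (z₅ (ha hm) hm)
    · exact Or.inr (Or.inr (hshare hP.adj₅ hP.adj₁ hm Set.subset_union_left))

/-- Either the part of the second pentagon off the first is connected, or the pentagons have two
common vertices that are not adjacent. -/
theorem IsPentagonOf.isPreconnected_diff_or (hG : G.CliqueFree 3) {C C' : G.Subgraph}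
    {a b c d e a' b' c' d' e' : V} (h : D.IsPentagonOf C a b c d e)
    (h' : D.IsPentagonOf C' a' b' c' d' e') :
    IsPreconnected (D.carrier C' \ D.carrier C) ∨ ∃ x₀ x₁ x₂ x₃ x₄,
      D.IsPentagonOf C' x₀ x₁ x₂ x₃ x₄ ∧ x₀ ∈ C.verts ∧ x₂ ∈ C.verts := by
  have key : ∀ {a' b' c' d' e' : V}, D.IsPentagonOf C' a' b' c' d' e' → e' ∈ C.verts →
      IsPreconnected (D.carrier C' \ D.carrier C) ∨ ∃ x₀ x₁ x₂ x₃ x₄,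
      D.IsPentagonOf C' x₀ x₁ x₂ x₃ x₄ ∧ x₀ ∈ C.verts ∧ x₂ ∈ C.verts := by
    intro a' b' c' d' e' h' he'
    by_cases hb : b' ∈ C.verts
    · exact Or.inr ⟨_, _, _, _, _, h'.rotate.rotate.rotate.rotate, he', hb⟩
    by_cases hc : c' ∈ C.verts
    · exact Or.inr ⟨_, _, _, _, _, h'.rotate.rotate, hc, he'⟩
    exact Or.inl (h.isPreconnected_diff hG h' (fun _ => he') (fun _ => he')
      (fun h1 => absurd h1 hc) fun h1 => absurd h1 hb)
  by_cases ha : a' ∈ C.verts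
  · exact key h'.rotate ha
  by_cases hb : b' ∈ C.verts
  · exact key h'.rotate.rotate hb
  by_cases hc : c' ∈ C.verts
  · exact key h'.rotate.rotate.rotate hc
  by_cases hd : d' ∈ C.verts
  · exact key h'.rotate.rotate.rotate.rotate hd
  exact Or.inl (h.isPreconnected_diff hG h' (fun h1 => absurd h1 hd) (fun h1 => absurd h1 ha)
      (fun h1 => absurd h1 hc) fun h1 => absurd h1 hb)

/-- Given two nonadjacent vertices of a pentagon, it can be labelled such that these are the
first and the third vertex. -/
theorem IsPentagonOf.exists_label {C : G.Subgraph} {a b c d e : V}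
    (h : D.IsPentagonOf C a b c d e) {x y : V} (hx : x ∈ C.verts) (hy : y ∈ C.verts)
    (hne : x ≠ y) (hxy : ¬ G.Adj x y) : ∃ p q r, D.IsPentagonOf C x p y q r := by
  have key : ∀ {b c d e : V}, D.IsPentagonOf C x b c d e → ∃ p q r, D.IsPentagonOf C x p y q r := by
    intro b c d e h
    have hP := h.isPentagon
    rcases (h.mem_verts_iff y).1 hy with rfl | rfl | rfl | rfl | rfl
    · exact absurd rfl hne
    · exact absurd hP.adj₁ hxy
    · exact ⟨_, _, _, h⟩
    · exact ⟨_, _, _, h.reverse⟩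
    · exact absurd hP.adj₅.symm hxy
  rcases (h.mem_verts_iff x).1 hx with rfl | rfl | rfl | rfl | rfl
  · exact key h
  · exact key h.rotate
  · exact key h.rotate.rotate
  · exact key h.rotate.rotate.rotate
  · exact key h.rotate.rotate.rotate.rotate

/-- If two cycles of length five of a triangle-free plane graph cross, then every vertex of the
first is on a cycle of length five that does not cross the second, and is crossed only by cycles
that cross the first or the second. -/
theorem exists_uncrossed (hG : G.CliqueFree 3) {C C' : G.Subgraph} (hC : IsFiveCycle C)
    (hC' : IsFiveCycle C') (hcross : ¬ Laminar (D.inside C) (D.inside C')) {v : V}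
    (hv : v ∈ C.verts) : ∃ C'' : G.Subgraph, IsFiveCycle C'' ∧ v ∈ C''.verts ∧
      Laminar (D.inside C') (D.inside C'') ∧ ∀ X, IsFiveCycle X →
        Laminar (D.inside X) (D.inside C) → Laminar (D.inside X) (D.inside C') →
          Laminar (D.inside X) (D.inside C'') := by
  obtain ⟨a, b, c, d, e, h⟩ := D.exists_isPentagonOf hC
  obtain ⟨a', b', c', d', e', h'⟩ := D.exists_isPentagonOf hC'
  rcases h.isPreconnected_diff_or hG h' with hpre | ⟨x₀, y₁, x₂, y₃, y₄, hY, hx₀, hx₂⟩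
  · exact absurd (h.isJordanCurve.laminar_inner h'.isJordanCurve hpre) hcross
  obtain ⟨x₁, x₃, x₄, hX⟩ := h.exists_label hx₀ hx₂ hY.isPentagon.ne₁
    (not_adj_of_cliqueFree hG hY.isPentagon.adj₁ hY.isPentagon.adj₂)
  have pX := hX.isPentagon
  have pY := hY.isPentagon
  -- exchange the paths of length three between the two common vertices
  have p₁ : IsPentagon G x₀ x₁ x₂ y₃ y₄ := by
    refine ⟨pX.adj₁, pX.adj₂, pY.adj₃, pY.adj₄, pY.adj₅, pX.ne₁, ?_, pY.ne₃, pY.ne₄, ?_⟩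
    · rintro rfl
      exact not_adj_of_cliqueFree hG pY.adj₄ pY.adj₅ pX.adj₁.symm
    · rintro rfl
      exact not_adj_of_cliqueFree hG pY.adj₃ pY.adj₄ pX.adj₂.symm
  have p₂ : IsPentagon G x₀ y₁ x₂ x₃ x₄ := by
    refine ⟨pY.adj₁, pY.adj₂, pX.adj₃, pX.adj₄, pX.adj₅, pX.ne₁, ?_, pX.ne₃, pX.ne₄, ?_⟩
    · rintro rfl
      exact not_adj_of_cliqueFree hG pX.adj₄ pX.adj₅ pY.adj₁.symm
    · rintro rfl
      exact not_adj_of_cliqueFree hG pX.adj₃ pX.adj₄ pY.adj₂.symm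
  have h₁ := D.isPentagonOf_toSubgraph p₁
  have h₂ := D.isPentagonOf_toSubgraph p₂
  set C₁ := (SimpleGraph.Walk.cons p₁.adj₁.symm p₁.walk).toSubgraph
  set C₂ := (SimpleGraph.Walk.cons p₂.adj₁.symm p₂.walk).toSubgraph
  have f₁ : IsFiveCycle C₁ := isFiveCycle_toSubgraph p₁
  have f₂ : IsFiveCycle C₂ := isFiveCycle_toSubgraph p₂
  have mX := hX.mem_verts_iff
  have mY := hY.mem_verts_iff
  have l₁ : Laminar (D.inside C) (D.inside C₁) := h.isJordanCurve.laminar_inner h₁.isJordanCurve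
    (h.isPreconnected_diff hG h₁.rotate.rotate.rotate (by simp [mX]) (by simp [mX])
      (by simp [mX]) (by simp [mX]))
  have l₁' : Laminar (D.inside C') (D.inside C₁) :=
    h'.isJordanCurve.laminar_inner h₁.isJordanCurve
    (h'.isPreconnected_diff hG h₁.rotate (by simp [mY]) (by simp [mY])
      (by simp [mY]) (by simp [mY]))
  have l₂ : Laminar (D.inside C) (D.inside C₂) := h.isJordanCurve.laminar_inner h₂.isJordanCurve
    (h.isPreconnected_diff hG h₂.rotate (by simp [mX]) (by simp [mX])
      (by simp [mX]) (by simp [mX]))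
  have l₂' : Laminar (D.inside C') (D.inside C₂) :=
    h'.isJordanCurve.laminar_inner h₂.isJordanCurve
    (h'.isPreconnected_diff hG h₂.rotate.rotate.rotate (by simp [mY]) (by simp [mY])
      (by simp [mY]) (by simp [mY]))
  -- compare the insides off the four cycles
  set U : Set Plane := (D.carrier C)ᶜ ∩ (D.carrier C')ᶜ ∩ ((D.carrier C₁)ᶜ ∩ (D.carrier C₂)ᶜ)
  have o := h.isJordanCurve.isCompact.isClosed.isOpen_compl
  have o' := h'.isJordanCurve.isCompact.isClosed.isOpen_compl
  have o₁ := h₁.isJordanCurve.isCompact.isClosed.isOpen_compl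
  have hU : Dense U :=
    (h.isJordanCurve.dense_compl.inter_of_isOpen_left
      h'.isJordanCurve.dense_compl o).inter_of_isOpen_left
      (h₁.isJordanCurve.dense_compl.inter_of_isOpen_left h₂.isJordanCurve.dense_compl o₁)
      (o.inter o')
  have hxor : ∀ p, (p ∈ D.inside C₁ ∩ U ↔ p ∈ D.inside C₂ ∩ U) ↔
      (p ∈ D.inside C ∩ U ↔ p ∈ D.inside C' ∩ U) := by
    intro p
    by_cases hp : p ∈ U
    · obtain ⟨⟨hp1, hp2⟩, hp3, hp4⟩ := hp
      rw [Set.mem_compl_iff, hX.carrier_eq] at hp1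
      rw [Set.mem_compl_iff, hY.carrier_eq] at hp2
      rw [Set.mem_compl_iff, h₁.carrier_eq] at hp3
      rw [Set.mem_compl_iff, h₂.carrier_eq] at hp4
      obtain ⟨N, hN, hNi⟩ := D.mem_inner_pentagon_iff pX hp1
      obtain ⟨N', hN', hNi'⟩ := D.mem_inner_pentagon_iff pY hp2
      obtain ⟨N₁, hN₁, hNi₁⟩ := D.mem_inner_pentagon_iff p₁ hp3
      obtain ⟨N₂, hN₂, hNi₂⟩ := D.mem_inner_pentagon_iff p₂ hp4
      have hsum : N₁ + N₂ = N + N' := by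
        have : ((N₁ + N₂ : ℂ)) * (2 * Real.pi * Complex.I) =
            (N + N') * (2 * Real.pi * Complex.I) := by
          linear_combination hN + hN' - hN₁ - hN₂
        exact_mod_cast mul_right_cancel₀ Complex.two_pi_I_ne_zero this
      have e : p ∈ D.inside C ↔ Odd N := by
        rw [← hNi, ← hX.carrier_eq]
        rfl
      have e' : p ∈ D.inside C' ↔ Odd N' := by
        rw [← hNi', ← hY.carrier_eq]
        rfl
      have e₁ : p ∈ D.inside C₁ ↔ Odd N₁ := by
        rw [← hNi₁, ← h₁.carrier_eq]
        rfl
      have e₂ : p ∈ D.inside C₂ ↔ Odd N₂ := by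
        rw [← hNi₂, ← h₂.carrier_eq]
        rfl
      have hpU : p ∈ U := by
        refine ⟨⟨?_, ?_⟩, ?_, ?_⟩
        · rwa [Set.mem_compl_iff, hX.carrier_eq]
        · rwa [Set.mem_compl_iff, hY.carrier_eq]
        · rwa [Set.mem_compl_iff, h₁.carrier_eq]
        · rwa [Set.mem_compl_iff, h₂.carrier_eq]
      simp only [Set.mem_inter_iff, hpU, and_true, e, e', e₁, e₂, Int.odd_iff]
      omega
    · simp [hp]
  have res : ∀ {A B : G.Subgraph}, IsFiveCycle A → IsFiveCycle B →
      (Laminar (D.inside A ∩ U) (D.inside B ∩ U) ↔ Laminar (D.inside A) (D.inside B)) := by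
    intro A B hA hB
    obtain ⟨_, _, _, _, _, hA⟩ := D.exists_isPentagonOf hA
    obtain ⟨_, _, _, _, _, hB⟩ := D.exists_isPentagonOf hB
    exact hA.isJordanCurve.laminar_inter_iff hB.isJordanCurve hU
  rw [← res hC hC'] at hcross
  rw [← res hC f₁] at l₁
  rw [← res hC f₂] at l₂
  have done : ∀ {A : G.Subgraph}, IsFiveCycle A → v ∈ A.verts →
      Laminar (D.inside C') (D.inside A) →
      (D.inside A ∩ U = D.inside C ∩ U ∩ (D.inside C' ∩ U) ∨
      D.inside A ∩ U = D.inside C ∩ U ∪ (D.inside C' ∩ U) ∨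
      D.inside A ∩ U = (D.inside C ∩ U) \ (D.inside C' ∩ U) ∨
      D.inside A ∩ U = (D.inside C' ∩ U) \ (D.inside C ∩ U)) →
      ∃ C'' : G.Subgraph, IsFiveCycle C'' ∧ v ∈ C''.verts ∧
      Laminar (D.inside C') (D.inside C'') ∧ ∀ X, IsFiveCycle X →
        Laminar (D.inside X) (D.inside C) → Laminar (D.inside X) (D.inside C') →
          Laminar (D.inside X) (D.inside C'') := by
    intro A hA hvA hlA heq
    refine ⟨A, hA, hvA, hlA, fun X hX h1 h2 => ?_⟩
    rw [← res hX hA]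
    exact Laminar.of_eq hcross heq ((res hX hC).2 h1) ((res hX hC').2 h2)
  rw [mX v] at hv
  by_cases hv1 : v ∈ C₁.verts
  · exact done f₁ hv1 l₁' (eq_of_laminar_of_xor hcross ((res f₁ hC').2 l₁'.symm) l₂.symm
      ((res f₂ hC').2 l₂'.symm) hxor)
  · refine done f₂ ?_ l₂' (eq_of_laminar_of_xor hcross ((res f₂ hC').2 l₂'.symm) l₁.symm
      ((res f₁ hC').2 l₁'.symm) fun p => Iff.trans Iff.comm (hxor p))
    rw [h₁.mem_verts_iff] at hv1
    rw [h₂.mem_verts_iff]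
    tauto

/-- In a triangle-free plane graph there is a family of cycles of length five, no two of which
cross, that covers all vertices of cycles of length five. -/
theorem exists_laminar_cover [Finite V] (D : PlaneDrawing G) (hG : G.CliqueFree 3) :
    ∃ F : Finset G.Subgraph, (∀ C ∈ F, IsFiveCycle C) ∧
      (∀ C ∈ F, ∀ C' ∈ F, Laminar (D.inside C) (D.inside C')) ∧
      ∀ C : G.Subgraph, IsFiveCycle C → ∀ v ∈ C.verts, ∃ C' ∈ F, v ∈ C'.verts := by
  classical
  have : Fintype G.Subgraph := Fintype.ofFinite _
  let good : Finset (Finset G.Subgraph) := Finset.univ.filter fun F =>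
    (∀ C ∈ F, IsFiveCycle C) ∧ ∀ C ∈ F, ∀ C' ∈ F, Laminar (D.inside C) (D.inside C')
  obtain ⟨F, hF, hmax⟩ := good.exists_max_image Finset.card ⟨∅, by simp [good]⟩
  simp only [good, Finset.mem_filter, Finset.mem_univ, true_and] at hF hmax
  refine ⟨F, hF.1, hF.2, ?_⟩
  by_contra! hcon
  obtain ⟨C₀, hC₀, v, hv₀, hvF⟩ := hcon
  -- a cycle through the uncovered vertex that crosses as few members of the family as possible
  let num : G.Subgraph → ℕ := fun C =>
    (F.filter fun X => ¬ Laminar (D.inside X) (D.inside C)).card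
  obtain ⟨C, hC, hmin⟩ := (Finset.univ.filter fun C : G.Subgraph => IsFiveCycle C ∧
    v ∈ C.verts).exists_min_image num ⟨C₀, by simp [hC₀, hv₀]⟩
  simp only [Finset.mem_filter, Finset.mem_univ, true_and] at hC hmin
  by_cases hall : ∀ X ∈ F, Laminar (D.inside X) (D.inside C)
  · have hCF : C ∉ F := fun h => hvF C h hC.2
    have := hmax (insert C F) ⟨by
      intro X hX
      rcases Finset.mem_insert.1 hX with rfl | hX
      exacts [hC.1, hF.1 X hX], by
      intro X hX Y hY
      rcases Finset.mem_insert.1 hX with rfl | hX' <;> rcases Finset.mem_insert.1 hY with rfl | hY'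
      exacts [Or.inr (Or.inl subset_rfl), (hall Y hY').symm, hall X hX', hF.2 X hX' Y hY']⟩
    rw [Finset.card_insert_of_notMem hCF] at this
    omega
  · push Not at hall
    obtain ⟨B, hB, hBC⟩ := hall
    obtain ⟨C', hC', hvC', hBC', hthird⟩ := exists_uncrossed hG hC.1 (hF.1 B hB)
      (fun h => hBC h.symm) hC.2
    refine absurd (hmin C' ⟨hC', hvC'⟩) (not_le.2 (Finset.card_lt_card ?_))
    rw [Finset.ssubset_iff_of_subset]
    · exact ⟨B, by simp [hB, hBC], by simp [hBC']⟩
    · intro X hX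
      simp only [Finset.mem_filter] at hX ⊢
      exact ⟨hX.1, fun h => hX.2 (hthird X (hF.1 X hX.1) h (hF.2 X hX.1 B hB))⟩

end PlaneDrawing

/-! ### Chains and antichains in laminar families -/

/-- Mirsky's theorem for laminar families. Members with the same set are ordered arbitrarily, so
that they form chains. -/
theorem card_le_mul_of_laminar {α β : Type*} [Countable α] (f : α → Set β) (q c : ℕ)
    (F : Finset α) (hlam : ∀ x ∈ F, ∀ y ∈ F, Laminar (f x) (f y))
    (hanti : ∀ A ⊆ F, (∀ x ∈ A, ∀ y ∈ A, x ≠ y → f x ∩ f y = ∅) → A.card ≤ q)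
    (hchain : ∀ A ⊆ F, (∀ x ∈ A, ∀ y ∈ A, f x ⊆ f y ∨ f y ⊆ f x) → A.card ≤ c) :
    F.card ≤ c * q := by
  classical
  obtain ⟨e, he⟩ := Countable.exists_injective_nat α
  induction c generalizing F with
  | zero =>
    rcases F.eq_empty_or_nonempty with rfl | ⟨x, hx⟩
    · simp
    · have := hchain {x} (by simpa using hx) (by simp)
      simp at this
  | succ c ih =>
    let g : α → Set β ×ₗ ℕ := fun x => toLex (f x, e x)
    -- the minimal members form an antichain, and removing them makes chains shorter
    let M := F.filter fun x => ∀ y ∈ F, ¬ g y < g x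
    have hMF : M ⊆ F := Finset.filter_subset _ _
    have hM : M.card ≤ q := by
      refine hanti M hMF fun x hx y hy hxy => ?_
      simp only [M, Finset.mem_filter] at hx hy
      have hne : ∀ {x y}, x ≠ y → f x ⊆ f y → ¬ g x < g y → ¬ g y < g x → False := by
        intro x y hxy hs h1 h2
        simp only [g, Prod.Lex.toLex_lt_toLex, not_or, not_and] at h1 h2
        have heq : f x = f y := by_contra fun h => h1.1 (hs.lt_of_ne h)
        have := h1.2 heq
        have := h2.2 heq.symm
        exact hxy (he (by omega))
      rcases hlam x hx.1 y hy.1 with h | h | h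
      · exact h
      · exact (hne hxy h (hy.2 x hx.1) (hx.2 y hy.1)).elim
      · exact (hne hxy.symm h (hx.2 y hy.1) (hy.2 x hx.1)).elim
    have hrest : (F \ M).card ≤ c * q := by
      refine ih (F \ M) (fun x hx y hy => hlam x (Finset.sdiff_subset hx) y
        (Finset.sdiff_subset hy)) (fun A hA => hanti A (hA.trans Finset.sdiff_subset))
        fun A hA hch => ?_
      rcases A.eq_empty_or_nonempty with rfl | hne
      · simp
      obtain ⟨x, hxA, hmin⟩ := Finset.exists_minimalFor g A hne
      obtain ⟨hxF, hxM⟩ := Finset.mem_sdiff.1 (hA hxA)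
      simp only [M, Finset.mem_filter, hxF, true_and, not_forall, not_not] at hxM
      obtain ⟨y, hyF, hyx⟩ := hxM
      have hyA : y ∉ A := fun h => hyx.not_ge (hmin h hyx.le)
      have hfyx : f y ⊆ f x := by
        rcases Prod.Lex.toLex_lt_toLex.1 hyx with h | h
        exacts [h.le, h.1.le]
      have hfx : ∀ z ∈ A, f x ⊆ f z := by
        intro z hz
        rcases hch x hxA z hz with h | h
        · exact h
        · by_contra hn
          have hlt : g z < g x := Prod.Lex.toLex_lt_toLex.2 (Or.inl (lt_of_le_not_ge h hn))
          exact hlt.not_ge (hmin hz hlt.le)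
      have hfy : ∀ z ∈ A, f y ⊆ f z := fun z hz => hfyx.trans (hfx z hz)
      have := hchain (insert y A)
        (Finset.insert_subset hyF (hA.trans Finset.sdiff_subset)) fun z hz w hw => by
          rcases Finset.mem_insert.1 hz with rfl | hz' <;>
            rcases Finset.mem_insert.1 hw with rfl | hw'
          exacts [Or.inl subset_rfl, Or.inl (hfy w hw'), Or.inr (hfy z hz'), hch z hz' w hw']
      rw [Finset.card_insert_of_notMem hyA] at this
      omega
    have := Finset.card_sdiff_add_card_eq_card hMF
    linarith [add_mul c 1 q]

/-! ### Vertices of small degree and the conclusion -/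

/-- A triangle in `G_v` uses the merged vertex and two edges at different neighbours of `v`. -/
theorem exists_isPentagon_of_not_cliqueFree {V : Type*} {G : SimpleGraph V} (hG : G.CliqueFree 3)
    {v : V} (h : ¬ (identifyNeighbors G v).CliqueFree 3) :
    ∃ a b c d, IsPentagon G v a b c d := by
  classical
  simp only [SimpleGraph.CliqueFree, not_forall, not_not] at h
  obtain ⟨s, hs⟩ := h
  obtain ⟨X, Y, Z, hXY, hXZ, hYZ, -⟩ := SimpleGraph.is3Clique_iff.1 hs
  have key : ∀ {X Y}, (identifyNeighbors G v).Adj X Y → ∃ x y : {u : V // u ≠ v},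
      Quotient.mk (neighborSetoid G v) x = X ∧ Quotient.mk (neighborSetoid G v) y = Y ∧
        G.Adj x y := by
    intro X Y h
    rw [identifyNeighbors, SimpleGraph.fromRel_adj] at h
    rcases h.2 with h | ⟨x, y, hx, hy, hxy⟩
    · exact h
    · exact ⟨y, x, hy, hx, hxy.symm⟩
  have hr : ∀ {x y : {u : V // u ≠ v}}, Quotient.mk (neighborSetoid G v) x =
      Quotient.mk (neighborSetoid G v) y → x = y ∨ (G.Adj v x ∧ G.Adj v y) :=
    fun h => Quotient.exact h
  -- the corners of a triangle where its two sides end in different vertices are merged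
  have hmain : ∀ {x y y' z z' x' : {u : V // u ≠ v}}, G.Adj x y → G.Adj y' z → G.Adj z' x' →
      (G.Adj v x ∧ G.Adj v x') → (y = y' ∨ (G.Adj v y ∧ G.Adj v y')) →
      (z = z' ∨ (G.Adj v z ∧ G.Adj v z')) → ∃ a b c d, IsPentagon G v a b c d := by
    intro x y y' z z' x' h1 h2 h3 ⟨hx, hx'⟩ hy hz
    have hy1 : ¬ G.Adj v y := not_adj_of_cliqueFree hG hx h1
    have hz1 : ¬ G.Adj v z' := not_adj_of_cliqueFree hG hx' h3.symm
    obtain rfl := hy.resolve_right fun h => hy1 h.1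
    obtain rfl := hz.resolve_right fun h => hz1 h.2
    refine ⟨x, y, z, x', hx, h1, h2, h3, hx'.symm, y.2.symm, ?_, ?_, z.2, ?_⟩
    · rintro h
      exact hz1 (h ▸ hx)
    · rintro h
      exact hy1 (h ▸ hx')
    · intro h
      exact not_adj_of_cliqueFree hG h1 h2 (h ▸ h3.symm)
  obtain ⟨x, y, rfl, rfl, h1⟩ := key hXY
  obtain ⟨y', z, hy, rfl, h2⟩ := key hYZ
  obtain ⟨z', x', hz, hx, h3⟩ := key hXZ.symm
  have hy := hr hy.symm
  have hz := hr hz.symm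
  have hx := hr hx.symm
  rcases hx with rfl | hx'
  · rcases hy with rfl | hy'
    · rcases hz with rfl | hz'
      · exact absurd h3.symm (not_adj_of_cliqueFree hG h1 h2)
      · exact hmain h3 h1 h2 hz'.symm (Or.inl rfl) (Or.inl rfl)
    · exact hmain h2 h3 h1 hy'.symm hz (Or.inl rfl)
  · exact hmain h1 h2 h3 hx' hy hz

theorem IsPentagon.two_le_degree {V : Type*} [Fintype V] {G : SimpleGraph V} [DecidableRel G.Adj]
    {v a b c d : V} (h : IsPentagon G v a b c d) : 2 ≤ G.degree v := by
  classical
  rw [← G.card_neighborFinset_eq_degree, ← Finset.card_pair h.ne₅.symm]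
  refine Finset.card_le_card fun x hx => ?_
  rw [SimpleGraph.mem_neighborFinset]
  rcases Finset.mem_insert.1 hx with rfl | hx
  · exact h.adj₁
  · exact Finset.mem_singleton.1 hx ▸ h.adj₅.symm

/-- If all degrees are at least two and the average degree is at most four, then many vertices
have degree at most `k`. -/
theorem mul_card_le_mul_card_degree_le {V : Type*} [Fintype V] {G : SimpleGraph V}
    [DecidableRel G.Adj] (hE : G.edgeFinset.card ≤ 2 * Fintype.card V) (k : ℕ) (hk : 3 ≤ k)
    (h2 : ∀ v, 2 ≤ G.degree v) :
    (k - 3) * Fintype.card V ≤ (k - 1) * (Finset.univ.filter fun v => G.degree v ≤ k).card := by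
  classical
  set m := (Finset.univ.filter fun v => G.degree v ≤ k).card
  have hsplit := Finset.card_filter_add_card_filter_not (s := (Finset.univ : Finset V))
    (fun v => G.degree v ≤ k)
  have hsum : ∑ v, (2 + if G.degree v ≤ k then 0 else k - 1) ≤ ∑ v, G.degree v := by
    refine Finset.sum_le_sum fun v _ => ?_
    have := h2 v
    split_ifs <;> omega
  rw [G.sum_degrees_eq_twice_card_edges, Finset.sum_add_distrib, Finset.sum_const,
    Finset.sum_ite, Finset.sum_const, Finset.sum_const, Finset.card_univ] at hsum
  simp only [smul_eq_mul, mul_zero, zero_add] at hsum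
  rw [Finset.card_univ] at hsplit
  obtain ⟨j, rfl⟩ := Nat.exists_eq_add_of_le hk
  have h1 : 3 + j - 3 = j := by omega
  have h3 : 3 + j - 1 = j + 2 := by omega
  rw [h1, h3]
  rw [h3] at hsum
  set h := (Finset.univ.filter fun v => ¬ G.degree v ≤ 3 + j).card
  change m + h = _ at hsplit
  nlinarith [congrArg ((j + 2) * ·) hsplit]

theorem lemma2p2 {V : Type*} [Fintype V] (G : SimpleGraph V) [DecidableRel G.Adj]
    (D : PlaneDrawing G) (hG : G.CliqueFree 3) (n : ℕ) (hn : Fintype.card V = n)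
    (k : ℕ) (hk : 3 ≤ k) :
    (∃ v : V, G.degree v ≤ k ∧ (identifyNeighbors G v).CliqueFree 3) ∨
    (∃ F : Finset G.Subgraph, (∀ C ∈ F, IsFiveCycle C) ∧ D.IsCycleAntichain F ∧
      Real.sqrt (6 * ((k : ℝ) - 3) * (n : ℝ) / (35 * ((k : ℝ) - 1))) ≤ (F.card : ℝ)) ∨
    (∃ F : Finset G.Subgraph, (∀ C ∈ F, IsFiveCycle C) ∧ D.IsCycleChain F ∧
      Real.sqrt (7 * ((k : ℝ) - 3) * (n : ℝ) / (30 * ((k : ℝ) - 1))) ≤ (F.card : ℝ)) := by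
  classical
  rw [or_iff_not_imp_left]
  intro hi
  push Not at hi
  have hpent : ∀ v, G.degree v ≤ k → ∃ a b c d, IsPentagon G v a b c d := fun v hv =>
    exists_isPentagon_of_not_cliqueFree hG (hi v hv)
  have hdeg : ∀ v, 2 ≤ G.degree v := by
    intro v
    rcases le_or_gt (G.degree v) k with h | h
    · obtain ⟨a, b, c, d, h⟩ := hpent v h
      exact h.two_le_degree
    · omega
  have hE : G.edgeFinset.card ≤ 2 * Fintype.card V := by
    rw [SimpleGraph.edgeFinset_card]
    exact D.card_edgeSet_le hG
  have hlow := mul_card_le_mul_card_degree_le hE k hk hdeg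
  obtain ⟨F, hF, hlam, hcov⟩ := D.exists_laminar_cover hG
  have hcard : (Finset.univ.filter fun v => G.degree v ≤ k).card ≤ F.card * 5 := by
    have hsub : (Finset.univ.filter fun v => G.degree v ≤ k) ⊆
        F.biUnion fun C => Finset.univ.filter fun v => v ∈ C.verts := by
      intro v hv
      obtain ⟨a, b, c, d, h⟩ := hpent v (Finset.mem_filter.1 hv).2
      obtain ⟨C, hC, hvC⟩ := hcov _ (PlaneDrawing.isFiveCycle_toSubgraph h) v
        (((D.isPentagonOf_toSubgraph h).mem_verts_iff v).2 (Or.inl rfl))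
      exact Finset.mem_biUnion.2 ⟨C, hC, by simpa using hvC⟩
    refine (Finset.card_le_card hsub).trans (Finset.card_biUnion_le_card_mul _ _ _ fun C hC => ?_)
    obtain ⟨a, b, c, d, e, h⟩ := D.exists_isPentagonOf (hF C hC)
    refine (Finset.card_le_card fun v hv => ?_).trans (Finset.card_le_five (a := a) (b := b)
      (c := c) (d := d) (e := e))
    have := (h.mem_verts_iff v).1 (Finset.mem_filter.1 hv).2
    simpa using this
  have hk1 : (0 : ℝ) < (k : ℝ) - 1 := by
    have : (3 : ℝ) ≤ k := by exact_mod_cast hk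
    linarith
  have hk3 : (0 : ℝ) ≤ (k : ℝ) - 3 := by
    have : (3 : ℝ) ≤ k := by exact_mod_cast hk
    linarith
  set a := Real.sqrt (6 * ((k : ℝ) - 3) * (n : ℝ) / (35 * ((k : ℝ) - 1))) with ha
  set b := Real.sqrt (7 * ((k : ℝ) - 3) * (n : ℝ) / (30 * ((k : ℝ) - 1))) with hb
  have hab : a * b = ((k : ℝ) - 3) * n / (5 * ((k : ℝ) - 1)) := by
    rw [ha, hb, ← Real.sqrt_mul (by positivity), ← Real.sqrt_sq (x := ((k : ℝ) - 3) * n / _)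
      (by positivity)]
    congr 1
    field_simp
    ring
  have hFab : a * b ≤ F.card := by
    have h1 : (((k - 3 : ℕ) : ℝ)) * n ≤ ((k - 1 : ℕ) : ℝ) * (F.card * 5) := by
      rw [← hn]
      exact_mod_cast hlow.trans (Nat.mul_le_mul_left _ hcard)
    rw [Nat.cast_sub hk, Nat.cast_sub (by omega : 1 ≤ k)] at h1
    push_cast at h1
    rw [hab, div_le_iff₀ (by positivity)]
    linarith
  by_contra! hcon
  obtain ⟨hanti, hchain⟩ := hcon
  have hapos : 0 < a := by simpa using hanti ∅ (by simp) (by simp [PlaneDrawing.IsCycleAntichain])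
  have hbpos : 0 < b := by simpa using hchain ∅ (by simp) (by simp [PlaneDrawing.IsCycleChain])
  -- the largest sizes of an antichain and of a chain in the family
  obtain ⟨A, hA, hAmax⟩ := (F.powerset.filter fun A => D.IsCycleAntichain A).exists_max_image
    Finset.card ⟨∅, Finset.mem_filter.2 ⟨by simp, by simp [PlaneDrawing.IsCycleAntichain]⟩⟩
  obtain ⟨B, hB, hBmax⟩ := (F.powerset.filter fun B => D.IsCycleChain B).exists_max_image
    Finset.card ⟨∅, Finset.mem_filter.2 ⟨by simp, by simp [PlaneDrawing.IsCycleChain]⟩⟩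
  simp only [Finset.mem_filter, Finset.mem_powerset] at hA hAmax hB hBmax
  have hmir := card_le_mul_of_laminar D.inside A.card B.card F hlam
    (fun S hS h => hAmax S ⟨hS, h⟩) (fun S hS h => hBmax S ⟨hS, h⟩)
  have h1 := hanti A (fun C hC => hF C (hA.1 hC)) hA.2
  have h2 := hchain B (fun C hC => hF C (hB.1 hC)) hB.2
  have h3 : (F.card : ℝ) ≤ B.card * A.card := by exact_mod_cast hmir
  have h4 : (B.card : ℝ) * A.card < b * a := mul_lt_mul'' h2 h1 (by positivity) (by positivity)
  linarith [mul_comm a b]
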